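/- Notation. For $\alpha\in\mathbb N^{\mathbb N}$ with $\alpha(i)\ge 2$ for all $i$, let $T_\alpha$ be the rooted tree in which every vertex of level $i$ has $\alpha(i)$ children; $V_n$ is its $n$-th level, $T_\alpha^v$ the subtree below a vertex $v$, and $\mathrm{Aut}(T_\alpha)$ its group of rooted automorphisms with the topology of pointwise convergence. For a closed subgroup $G\le \mathrm{Aut}(T_\alpha)$, $\mathrm{st}_G(n)$ is the pointwise stabilizer of $V_n$, $\mathrm{rist}_G(v)$ the subgroup of elements fixing every vertex outside $T_\alpha^v$, and $\mathrm{rist}_G(n)=\langle \mathrm{rist}_G(v)\mid v\in V_n\rangle$. A profinite group is a *profinite branch group* if, for some such $\alpha$, it is isomorphic to a closed subgroup $G\le\mathrm{Aut}(T_\alpha)$ that is transitive on every level and such that $\mathrm{rist}_G(n)$ has finite index in $G$ for every $n$. With respect to such an identification, $G$ *locally has derangements* if for every $n$ there is $N\ge n$ such that some element of $\mathrm{st}_G(n)$ fixes no vertex of $V_N$. It has *uniform commutator widths* if there is $c\in\mathbb N$ such that for every vertex $v$ every element of the abstract derived subgroup of $\mathrm{rist}_G(v)$ is a product of at most $c$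 commutators of elements of $\mathrm{rist}_G(v)$. A topological group is *strongly just infinite* if each of its nontrivial (abstract) normal subgroups is open and of finite index. The first Grigorchuk group $G_1$ is the subgroup of $\mathrm{Aut}(T_2)$, where the vertices of $T_2$ are the finite binary sequences, generated by $a,b,c,d$, where $$a(0\alpha)=1\alpha,\quad a(1\alpha)=0\alpha,\quad b(0\alpha)=0\,a(\alpha),\quad b(1\alpha)=1\,c(\alpha),$$ $$c(0\alpha)=0\,a(\alpha),\quad c(1\alpha)=1\,d(\alpha),\quad d(0\alpha)=0\alpha,\quad d(1\alpha)=1\,b(\alpha).$$ **Theorem.** Let $\widehat{G}_1$ be the profinite completion of $G_1$. Then $\widehat G_1$ is a strongly just infinite profinite branch group. More precisely, the inclusion $G_1\le \mathrm{Aut}(T_2)$ extends to a homomorphism $\widehat G_1\to\mathrm{Aut}(T_2)$ that is a topological isomorphism onto a closed subgroup which is transitive on every level and has all rigid level stabilizers of finite index, and with respect to this identification $\widehat G_1$ locally has derangements and has uniform commutator widths. Consequently $\widehat G_1$ has the following automatic continuity properties: 1. (normal countable index property) every normal subgroup of countable index is open; 2. (countable index property) every subgroup of countable index is open; 3. (weak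 Steinhaus property) for every $A\subseteq \widehat G_1$ with $A=A^{-1}$ such that countably many left translates of $A$ cover $\widehat G_1$, there is $n\in\mathbb N$ such that $A^n$ contains a neighbourhood of $1$; 4. (invariant automatic continuity property) every homomorphism from $\widehat G_1$ to a Polish group in which the conjugation invariant neighbourhoods of $1$ form a neighbourhood basis at $1$ is continuous; 5. (locally compact automatic continuity property) every homomorphism from $\widehat G_1$ to a locally compact Polish group is continuous. -/

import Mathlib

open Topology
open scoped Pointwise

namespace BranchGroup

/-! ### Spherically homogeneous rooted trees and their automorphism groups -/

/-- The vertices of the spherically homogeneous rooted tree `T_α`: finite sequences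
`(x₀, …, x_{n-1})` of natural numbers with `x_i < α i`.  The root is the empty sequence, the level
of a vertex is its length, and the children of `v` are the one-letter extensions of `v`. -/
def Vertex (α : ℕ → ℕ) : Type :=
  {l : List ℕ // ∀ (i : ℕ) (h : i < l.length), l[i] < α i}

/-- The level of a vertex, i.e. its distance to the root. -/
def Vertex.level {α : ℕ → ℕ} (v : Vertex α) : ℕ := v.1.length

/-- The neighbour of `v` on the path to the root (with the convention that the parent of the root is
the root). -/
def Vertex.parent {α : ℕ → ℕ} (v : Vertex α) : Vertex α :=
  ⟨v.1.dropLast, fun i h => by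
    rw [List.getElem_dropLast]
    exact v.2 i _⟩

/-- `Below v w` : the vertex `w` belongs to the tree `T_α^v` below `v`, i.e. `v` lies on the path
from the root to `w`. -/
def Vertex.Below {α : ℕ → ℕ} (v w : Vertex α) : Prop := v.1 <+: w.1

/-- The group `Aut(T_α)` of rooted tree automorphisms: the permutations of the vertex set that
commute with `parent`.  (As the root is the only vertex that is its own parent, these are exactly
the graph automorphisms that fix the root.) -/
def treeAut (α : ℕ → ℕ) : Subgroup (Equiv.Perm (Vertex α)) where
  carrier := {σ | ∀ v, σ v.parent = (σ v).parent}
  one_mem' := fun _ => rfl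
  mul_mem' := by
    intro σ τ hσ hτ v
    rw [Equiv.Perm.mul_apply, Equiv.Perm.mul_apply, hτ, hσ]
  inv_mem' := by
    intro σ hσ v
    rw [Equiv.Perm.inv_eq_iff_eq, hσ]
    exact congrArg Vertex.parent (σ.apply_symm_apply v).symm

/-- The profinite topology of `Aut(T_α)`: pointwise convergence on the discrete set of vertices. -/
instance treeAutTopology (α : ℕ → ℕ) : TopologicalSpace (treeAut α) :=
  TopologicalSpace.induced (fun g : treeAut α => (g.1 : Vertex α → Vertex α))
    (@Pi.topologicalSpace (Vertex α) (fun _ => Vertex α) (fun _ => ⊥))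

/-! ### Profinite branch groups

A group `G` acting on `T_α` is given by a homomorphism `φ : G →* treeAut α`. -/

section Action

variable {α : ℕ → ℕ} {G : Type*} [Group G]

/-- The rigid stabilizer of the vertex `v` in `G`: the elements which fix every vertex outside the
tree below `v`. -/
def rist (φ : G →* treeAut α) (v : Vertex α) : Subgroup G where
  carrier := {g | ∀ w, ¬ v.Below w → (φ g).1 w = w}
  one_mem' := fun w _ => by simp
  mul_mem' := by
    intro g h hg hh w hw
    rw [map_mul, Subgroup.coe_mul, Equiv.Perm.mul_apply, hh w hw, hg w hw]
  inv_mem' := by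
    intro g hg w hw
    rw [map_inv, Subgroup.coe_inv, Equiv.Perm.inv_eq_iff_eq, hg w hw]

/-- The `n`-th rigid level stabilizer: the subgroup generated by the rigid stabilizers of the
vertices of level `n`. -/
def ristLevel (φ : G →* treeAut α) (n : ℕ) : Subgroup G :=
  ⨆ v : {v : Vertex α // v.level = n}, rist φ v.1

/-- `φ` identifies the topological group `G` with a closed subgroup of `Aut(T_α)` which acts
transitively on every level and whose rigid level stabilizers all have finite index. -/
structure IsBranchEmbedding [TopologicalSpace G] (φ : G →* treeAut α) : Prop where
  isClosedEmbedding : IsClosedEmbedding φ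
  transitive : ∀ v w : Vertex α, v.level = w.level → ∃ g : G, (φ g).1 v = w
  finiteIndex_ristLevel : ∀ n : ℕ, (ristLevel φ n).FiniteIndex

/-- `G` locally has derangements: for every `n` there is `N ≥ n` such that the pointwise stabilizer
of level `n` contains an element without fixed points in level `N`. -/
def LocallyHasDerangements (φ : G →* treeAut α) : Prop :=
  ∀ n : ℕ, ∃ N : ℕ, n ≤ N ∧ ∃ g : G,
    (∀ v : Vertex α, v.level = n → (φ g).1 v = v) ∧
    (∀ v : Vertex α, v.level = N → (φ g).1 v ≠ v)

end Action

/-- A profinite group is a profinite branch group if it is isomorphic to a closed subgroup of some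
`Aut(T_α)`, where `α i ≥ 2` for all `i`, which acts transitively on every level and whose rigid
level stabilizers all have finite index. -/
def IsProfiniteBranchGroup (G : ProfiniteGrp) : Prop :=
  ∃ α : ℕ → ℕ, (∀ i, 2 ≤ α i) ∧ ∃ φ : G →* treeAut α, IsBranchEmbedding φ

/-- The least `n` such that `g` is a product of `n` commutators (`⊤` if there is none). -/
noncomputable def commutatorLength {G : Type*} [Group G] (g : G) : ℕ∞ :=
  ⨅ (l : List (G × G)) (_ : (l.map fun p => p.1 * p.2 * p.1⁻¹ * p.2⁻¹).prod = g), (l.length : ℕ∞)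

/-- The commutator width of `G`: the supremum of the commutator lengths of the elements of the
(abstract) derived subgroup. -/
noncomputable def commutatorWidth (G : Type*) [Group G] : ℕ∞ :=
  ⨆ g : commutator G, commutatorLength (g : G)

/-- `G` has uniform commutator widths: the commutator widths of its rigid stabilizers are bounded. -/
def HasUniformCommutatorWidths {α : ℕ → ℕ} {G : Type*} [Group G] (φ : G →* treeAut α) : Prop :=
  (⨆ v : Vertex α, commutatorWidth (rist φ v)) < ⊤

/-! ### Strongly just infinite groups and automatic continuity properties -/

section Properties

variable (G : Type*) [Group G] [TopologicalSpace G]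

/-- Every nontrivial (abstract) normal subgroup is open with finite index. -/
def StronglyJustInfinite : Prop :=
  ∀ N : Subgroup G, N.Normal → N ≠ ⊥ → IsOpen (N : Set G) ∧ N.FiniteIndex

/-- Every normal subgroup of countable index is open. -/
def NormalCountableIndexProperty : Prop :=
  ∀ N : Subgroup G, N.Normal → Countable (G ⧸ N) → IsOpen (N : Set G)

/-- Every subgroup of countable index is open. -/
def CountableIndexProperty : Prop :=
  ∀ H : Subgroup G, Countable (G ⧸ H) → IsOpen (H : Set G)

variable {G} in
/-- Countably many left translates of `A` cover `G`. -/
def IsSigmaSyndetic (A : Set G) : Prop :=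
  ∃ g : ℕ → G, (⋃ n, g n • A) = Set.univ

/-- Every symmetric `σ`-syndetic set has a power that is a neighbourhood of `1`. -/
def WeakSteinhausProperty : Prop :=
  ∀ A : Set G, A⁻¹ = A → IsSigmaSyndetic A → ∃ n : ℕ, A ^ n ∈ 𝓝 (1 : G)

/-- A small invariant neighbourhood group: the conjugation invariant neighbourhoods of `1` form a
basis of neighbourhoods of `1`. -/
def IsSINGroup : Prop :=
  ∀ U ∈ 𝓝 (1 : G), ∃ V ∈ 𝓝 (1 : G), V ⊆ U ∧ ∀ g : G, ∀ x ∈ V, g * x * g⁻¹ ∈ V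

/-- Every (abstract) homomorphism to a SIN Polish group is continuous.  (A Polish group has at most
continuum many elements, so it is isomorphic to one whose underlying type is in `Type`.) -/
def InvariantAutomaticContinuityProperty : Prop :=
  ∀ (H : Type) [Group H] [TopologicalSpace H] [IsTopologicalGroup H] [PolishSpace H],
    IsSINGroup H → ∀ ψ : G →* H, Continuous ψ

/-- Every (abstract) homomorphism to a locally compact Polish group is continuous. -/
def LocallyCompactAutomaticContinuityProperty : Prop :=
  ∀ (H : Type) [Group H] [TopologicalSpace H] [IsTopologicalGroup H] [PolishSpace H]
    [LocallyCompactSpace H], ∀ ψ : G →* H, Continuous ψ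

end Properties

/-! ### The first Grigorchuk group -/

/-- Names for the four generators of the first Grigorchuk group. -/
inductive GrigorchukGen
  | a | b | c | d

/-- The recursive action of the generators on finite sequences over `{0, 1}`; letters other than
`0` and `1` do not occur in vertices of the binary tree, and are left alone. -/
def grigorchukAct : GrigorchukGen → List ℕ → List ℕ
  | _, [] => []
  | .a, 0 :: l => 1 :: l
  | .a, 1 :: l => 0 :: l
  | .b, 0 :: l => 0 :: grigorchukAct .a l
  | .b, 1 :: l => 1 :: grigorchukAct .c l
  | .c, 0 :: l => 0 :: grigorchukAct .a l
  | .c, 1 :: l => 1 :: grigorchukAct .d l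
  | .d, 0 :: l => 0 :: l
  | .d, 1 :: l => 1 :: grigorchukAct .b l
  | _, (x + 2) :: l => (x + 2) :: l

theorem length_grigorchukAct (s : GrigorchukGen) (l : List ℕ) :
    (grigorchukAct s l).length = l.length := by
  induction l generalizing s with
  | nil => cases s <;> simp [grigorchukAct]
  | cons x l ih => rcases x with _ | _ | x <;> cases s <;> simp [grigorchukAct, ih]

theorem grigorchukAct_grigorchukAct (s : GrigorchukGen) (l : List ℕ) :
    grigorchukAct s (grigorchukAct s l) = l := by
  induction l generalizing s with
  | nil => cases s <;> simp [grigorchukAct]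
  | cons x l ih => rcases x with _ | _ | x <;> cases s <;> simp [grigorchukAct, ih]

theorem grigorchukAct_lt_two (s : GrigorchukGen) (l : List ℕ) (hl : ∀ x ∈ l, x < 2) :
    ∀ x ∈ grigorchukAct s l, x < 2 := by
  induction l generalizing s with
  | nil => cases s <;> simp [grigorchukAct]
  | cons x l ih =>
    have hl' : ∀ y ∈ l, y < 2 := fun y hy => hl y (List.mem_cons_of_mem _ hy)
    rcases x with _ | _ | x
    · cases s <;> simp only [grigorchukAct, List.forall_mem_cons] <;>
        exact ⟨by norm_num, by first | exact hl' | exact ih _ hl'⟩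
    · cases s <;> simp only [grigorchukAct, List.forall_mem_cons] <;>
        exact ⟨by norm_num, by first | exact hl' | exact ih _ hl'⟩
    · exact absurd (hl (x + 2) List.mem_cons_self) (by omega)

theorem grigorchukAct_dropLast (s : GrigorchukGen) (l : List ℕ) :
    grigorchukAct s l.dropLast = (grigorchukAct s l).dropLast := by
  induction l generalizing s with
  | nil => cases s <;> simp [grigorchukAct]
  | cons x l ih =>
    rcases l with _ | ⟨y, l⟩
    · rcases x with _ | _ | x <;> cases s <;> simp [grigorchukAct]
    · have key : ∀ (z : ℕ) (m : List ℕ), m ≠ [] → z :: m.dropLast = (z :: m).dropLast :=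
        fun z m hm => (List.dropLast_cons_of_ne_nil hm).symm
      have hne : ∀ s, grigorchukAct s (y :: l) ≠ [] := fun s h => by
        have := length_grigorchukAct s (y :: l)
        simp [h] at this
      rw [List.dropLast_cons_of_ne_nil (List.cons_ne_nil y l)]
      rcases x with _ | _ | x <;> cases s <;> simp only [grigorchukAct, ih] <;>
        exact key _ _ (by first | exact hne _ | exact List.cons_ne_nil y l)

/-- The binary tree `T_2` is `Vertex binary`. -/
abbrev binary : ℕ → ℕ := fun _ => 2

/-- The generators of the first Grigorchuk group as automorphisms of the binary rooted tree. -/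
def grigorchukGenerator (s : GrigorchukGen) : treeAut binary :=
  ⟨Function.Involutive.toPerm
    (fun v : Vertex binary => (⟨grigorchukAct s v.1, fun i h =>
      grigorchukAct_lt_two s v.1
        (fun x hx => by
          obtain ⟨j, hj, rfl⟩ := List.mem_iff_getElem.1 hx
          exact v.2 j hj)
        _ (List.getElem_mem h)⟩ : Vertex binary))
    (fun v => Subtype.ext (grigorchukAct_grigorchukAct s v.1)),
  fun v => Subtype.ext (grigorchukAct_dropLast s v.1)⟩

/-- The first Grigorchuk group, generated by `a`, `b`, `c`, `d` inside `Aut(T_2)`. -/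
def grigorchukGroup : Subgroup (treeAut binary) :=
  Subgroup.closure (Set.range grigorchukGenerator)

/-- The profinite completion of the first Grigorchuk group: the inverse limit of all its finite
quotients. -/
noncomputable def grigorchukCompletion : ProfiniteGrp.{0} :=
  ProfiniteGrp.ProfiniteCompletion.completion (GrpCat.of grigorchukGroup)

/-- The canonical homomorphism from the first Grigorchuk group to its profinite completion. -/
noncomputable def toGrigorchukCompletion : grigorchukGroup →* grigorchukCompletion :=
  (ProfiniteGrp.ProfiniteCompletion.eta (GrpCat.of grigorchukGroup)).hom

end BranchGroup

open BranchGroup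

/-!
The proof replaces the profinite completion by a concrete group. Let `G` be the Grigorchuk group
and `K` the normal closure of `(ab)²` in it (`grigK`). Then `G` is regular branch over `K` in a
strong form: `K × K ≤ K`, and even `K × 1 ≤ [K, G]` (`atLetter_mem_commutator`), the third level
stabilizer of `G` lies in `K` (`levelStab_three_le`), and every element of `G` is a section of
some element of `K` at any given vertex of level three (`liftsToK_three`). By the last fact, a
commutator of an element of `K` with an element of `G`, placed below a vertex of level three, is a
commutator of two elements of `K`. Hence `[K, K]` contains the seventh level stabilizer, and as
every nontrivial normal subgroup contains `[K, K]` below all vertices of some level, it contains a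
level stabilizer (`IsBranchPair.exists_levelStab_le`). Applied to `G` this is the congruence
subgroup property, so the completion is the closure of `G` in `Aut(T_2)`
(`completionHom_injective`, `range_completionHom`). Applied to the closures of `G` and `K` it
shows that the completion is strongly just infinite.

All quantitative statements rest on one bound: the elements of the seventh level stabilizer of the
closure of `G` are products of `64` commutators of elements of the closure of `K`
(`levelStab_subset_pow`). In the finite `2`-groups `G / St(n)`, which are nilpotent, each element
of `[K, G]` is a product of four commutators, one with each generator of `G` (`exists_commProd`),
and compactness carries this over to the closure. The bound gives the uniform commutator widths,
because a rigid vertex stabilizer is isomorphic to a group between the closures of `K` and `G`,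
and such groups are determined by a fixed finite quotient. Products of copies of `(ab)²` over a
level are local derangements.

For the weak Steinhaus property, let countably many translates of a symmetric set `A` cover the
group. A diagonal argument with infinite products along a ray (`exists_ray_full`) shows that `A²`
contains elements with arbitrary part in the closure of `K` below some vertex. Doing this twice,
and taking commutators, puts a level stabilizer below a single vertex into a fixed power of `A`.
By the Baire category theorem the closure of `A²` contains a level stabilizer. This can be done
below each of the finitely many vertices of a suitable level, and there the elements of `A²` move
the vertex found to the others of its level; so a power of `A` contains a level stabilizer. If `A`
is conjugation invariant, one element of `A²` that moves all vertices of some level suffices, and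
the exponent is always `1024` (`exists_levelStab_subset_pow_of_invariant`). This uniformity gives
the invariant automatic continuity property. A subgroup of countable index is the case `A = A^n`
of the weak Steinhaus property, and under a homomorphism to a locally compact group the image is
relatively compact by the same property, whence compactness of its closure reduces the claim to
the invariant case.
-/

namespace BranchGroup

open scoped commutatorElement

/-! ### Vertices and automorphisms of the binary tree -/

/-- The automorphism group of the binary rooted tree. -/
abbrev BinAut : Type := treeAut binary

/-- The root of the binary tree. -/
def root : Vertex binary := ⟨[], fun i h => absurd h (Nat.not_lt_zero i)⟩

/-- The vertex obtained from `v` by prefixing the letter `i` (`false` is `0`, `true` is `1`). -/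
def cons (i : Bool) (v : Vertex binary) : Vertex binary :=
  ⟨i.toNat :: v.1, fun j h => by
    rcases j with _ | j
    · exact Bool.toNat_lt i
    · exact v.2 j (by simpa using h)⟩

@[elab_as_elim]
theorem vertex_induction {P : Vertex binary → Prop} (hr : P root)
    (hc : ∀ i v, P v → P (cons i v)) (v : Vertex binary) : P v := by
  obtain ⟨l, hl⟩ := v
  induction l with
  | nil => exact hr
  | cons x l ih =>
    have hl' : ∀ (i : ℕ) (h : i < l.length), l[i] < binary i := fun i h => by
      have := hl (i + 1) (by simpa using h)
      simpa using this
    have hx : x < 2 := hl 0 (by simp)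
    have := hc (x == 1) ⟨l, hl'⟩ (ih hl')
    have he : (⟨x :: l, hl⟩ : Vertex binary) = cons (x == 1) ⟨l, hl'⟩ := by
      apply Subtype.ext
      simp only [cons]
      interval_cases x <;> rfl
    rw [he]
    exact this

theorem vertex_cases (v : Vertex binary) : v = root ∨ ∃ i w, v = cons i w := by
  induction v using vertex_induction with
  | hr => exact Or.inl rfl
  | hc i v _ => exact Or.inr ⟨i, v, rfl⟩

@[simp] theorem cons_ne_root (i : Bool) (v : Vertex binary) : cons i v ≠ root := fun h => by
  have := congrArg Subtype.val h
  simp [cons, root] at this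

@[simp] theorem cons_inj {i j : Bool} {v w : Vertex binary} :
    cons i v = cons j w ↔ i = j ∧ v = w := by
  constructor
  · intro h
    have := congrArg Subtype.val h
    simp only [cons, List.cons.injEq] at this
    refine ⟨?_, Subtype.ext this.2⟩
    cases i <;> cases j <;> simp_all
  · rintro ⟨rfl, rfl⟩; rfl

@[simp] theorem level_root : root.level = 0 := rfl
@[simp] theorem level_cons (i : Bool) (v : Vertex binary) : (cons i v).level = v.level + 1 := rfl

@[simp] theorem parent_root : root.parent = root := rfl
theorem parent_cons_of_ne (i : Bool) {v : Vertex binary} (hv : v ≠ root) :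
    (cons i v).parent = cons i v.parent := by
  rcases vertex_cases v with rfl | ⟨j, w, rfl⟩
  · exact absurd rfl hv
  · rfl

@[simp] theorem below_root (v : Vertex binary) : root.Below v := List.nil_prefix

@[simp] theorem cons_below_cons {i j : Bool} {v w : Vertex binary} :
    (cons i v).Below (cons j w) ↔ i = j ∧ v.Below w := by
  simp only [Vertex.Below, cons, List.cons_prefix_cons]
  refine and_congr_left fun _ => ?_
  cases i <;> cases j <;> simp

theorem level_parent (v : Vertex binary) : v.parent.level = v.level - 1 := by
  simp [Vertex.level, Vertex.parent]

theorem level_eq_zero {v : Vertex binary} : v.level = 0 ↔ v = root := by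
  rcases vertex_cases v with rfl | ⟨j, w, rfl⟩ <;> simp

theorem level_eq_succ {v : Vertex binary} {n : ℕ} :
    v.level = n + 1 ↔ ∃ i w, w.level = n ∧ v = cons i w := by
  rcases vertex_cases v with rfl | ⟨j, w, rfl⟩
  · simp [fun i w => (cons_ne_root i w).symm]
  · simp

@[ext] theorem binAut_ext {g h : BinAut} (H : ∀ v, g.1 v = h.1 v) : g = h :=
  Subtype.ext (Equiv.ext H)

@[simp] theorem mul_act (g h : BinAut) (v : Vertex binary) : (g * h).1 v = g.1 (h.1 v) := rfl
@[simp] theorem one_act (v : Vertex binary) : (1 : BinAut).1 v = v := rfl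
@[simp] theorem inv_act_act (g : BinAut) (v : Vertex binary) : (g⁻¹).1 (g.1 v) = v :=
  g.1.symm_apply_apply v
@[simp] theorem act_inv_act (g : BinAut) (v : Vertex binary) : g.1 ((g⁻¹).1 v) = v :=
  g.1.apply_symm_apply v
theorem act_parent (g : BinAut) (v : Vertex binary) : g.1 v.parent = (g.1 v).parent := g.2 v

theorem parent_eq_self {v : Vertex binary} : v.parent = v ↔ v = root := by
  constructor
  · intro h
    have h1 := level_parent v
    rw [h] at h1
    exact level_eq_zero.1 (by omega)
  · rintro rfl; rfl

@[simp] theorem act_root (g : BinAut) : g.1 root = root := by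
  rw [← parent_eq_self, ← act_parent, parent_root]

@[simp] theorem act_eq_root {g : BinAut} {v : Vertex binary} : g.1 v = root ↔ v = root := by
  constructor
  · intro h
    rw [← inv_act_act g v, h, act_root]
  · rintro rfl; exact act_root g

@[simp] theorem level_act (g : BinAut) (v : Vertex binary) : (g.1 v).level = v.level := by
  generalize hn : v.level = n
  induction n generalizing v with
  | zero => rw [level_eq_zero] at hn ⊢; simp [hn]
  | succ n ih =>
    have h1 := ih v.parent (by rw [level_parent, hn]; rfl)
    rw [act_parent, level_parent] at h1
    have h2 : (g.1 v).level ≠ 0 := by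
      rw [Ne, level_eq_zero, act_eq_root, ← level_eq_zero]; omega
    omega

/-! ### Sections -/

/-- The automorphism acting as `g` below `0` and as `h` below `1`. -/
def pair (g h : BinAut) : BinAut where
  val :=
    { toFun := fun v => match v with
        | ⟨[], _⟩ => root
        | ⟨0 :: l, hl⟩ => cons false (g.1 ⟨l, fun i h => hl (i + 1) (Nat.succ_lt_succ h)⟩)
        | ⟨(_ + 1) :: l, hl⟩ =>
          cons true (h.1 ⟨l, fun i h => hl (i + 1) (Nat.succ_lt_succ h)⟩)
      invFun := fun v => match v with
        | ⟨[], _⟩ => root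
        | ⟨0 :: l, hl⟩ =>
          cons false ((g⁻¹).1 ⟨l, fun i h => hl (i + 1) (Nat.succ_lt_succ h)⟩)
        | ⟨(_ + 1) :: l, hl⟩ =>
          cons true ((h⁻¹).1 ⟨l, fun i h => hl (i + 1) (Nat.succ_lt_succ h)⟩)
      left_inv := fun v => by
        rcases vertex_cases v with rfl | ⟨_ | _, w, rfl⟩
        · rfl
        · exact congrArg (cons false) (inv_act_act g w)
        · exact congrArg (cons true) (inv_act_act h w)
      right_inv := fun v => by
        rcases vertex_cases v with rfl | ⟨_ | _, w, rfl⟩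
        · rfl
        · exact congrArg (cons false) (act_inv_act g w)
        · exact congrArg (cons true) (act_inv_act h w) }
  property := fun v => by
    rcases vertex_cases v with rfl | ⟨_ | _, w, rfl⟩
    · rfl
    · by_cases hw : w = root
      · subst hw
        exact (congrArg (fun u => (cons false u).parent) (act_root g)).symm
      · rw [parent_cons_of_ne _ hw]
        change cons false (g.1 w.parent) = (cons false (g.1 w)).parent
        rw [parent_cons_of_ne _ (by simpa using hw), act_parent]
    · by_cases hw : w = root
      · subst hw
        exact (congrArg (fun u => (cons true u).parent) (act_root h)).symm
      · rw [parent_cons_of_ne _ hw]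
        change cons true (h.1 w.parent) = (cons true (h.1 w)).parent
        rw [parent_cons_of_ne _ (by simpa using hw), act_parent]

@[simp] theorem pair_false (g h : BinAut) (v : Vertex binary) :
    (pair g h).1 (cons false v) = cons false (g.1 v) := rfl
@[simp] theorem pair_true (g h : BinAut) (v : Vertex binary) :
    (pair g h).1 (cons true v) = cons true (h.1 v) := rfl

theorem binAut_ext' {g h : BinAut} (h0 : ∀ v, g.1 (cons false v) = h.1 (cons false v))
    (h1 : ∀ v, g.1 (cons true v) = h.1 (cons true v)) : g = h := by
  ext v
  rcases vertex_cases v with rfl | ⟨_ | _, w, rfl⟩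
  · simp
  · exact h0 w
  · exact h1 w

@[simp] theorem pair_mul (g h g' h' : BinAut) : pair g h * pair g' h' = pair (g * g') (h * h') :=
  binAut_ext' (fun _ => rfl) (fun _ => rfl)

@[simp] theorem pair_one : pair 1 1 = 1 := binAut_ext' (fun _ => rfl) (fun _ => rfl)

@[simp] theorem pair_inv (g h : BinAut) : (pair g h)⁻¹ = pair g⁻¹ h⁻¹ :=
  inv_eq_of_mul_eq_one_right (by simp)

@[simp] theorem pair_inj {g h g' h' : BinAut} : pair g h = pair g' h' ↔ g = g' ∧ h = h' := by
  refine ⟨fun H => ⟨?_, ?_⟩, fun H => by rw [H.1, H.2]⟩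
  · ext v
    have := congrArg (fun k : BinAut => k.1 (cons false v)) H
    simpa using this
  · ext v
    have := congrArg (fun k : BinAut => k.1 (cons true v)) H
    simpa using this

@[simp] theorem pair_eq_one {g h : BinAut} : pair g h = 1 ↔ g = 1 ∧ h = 1 := by
  conv_lhs => rw [← pair_one, pair_inj]

@[simp] theorem pair_pow (g h : BinAut) (n : ℕ) : pair g h ^ n = pair (g ^ n) (h ^ n) := by
  induction n with
  | zero => simp
  | succ n ih => rw [pow_succ, ih, pair_mul, ← pow_succ, ← pow_succ]

@[simp] theorem pair_commutator (g h g' h' : BinAut) :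
    ⁅pair g h, pair g' h'⁆ = pair ⁅g, g'⁆ ⁅h, h'⁆ := by
  simp [commutatorElement_def]

/-- An automorphism that moves the vertex `i` of level one to `j` maps the subtree below `i` to the
subtree below `j`. -/
theorem exists_act_cons {g : BinAut} {i j : Bool} (hg : g.1 (cons i root) = cons j root)
    (v : Vertex binary) : ∃ w, g.1 (cons i v) = cons j w := by
  generalize hn : v.level = n
  induction n generalizing v with
  | zero =>
    rw [level_eq_zero] at hn
    exact ⟨root, by rw [hn, hg]⟩
  | succ n ih =>
    have hv : v ≠ root := by rw [Ne, ← level_eq_zero]; omega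
    obtain ⟨w, hw⟩ := ih v.parent (by rw [level_parent, hn]; rfl)
    rw [← parent_cons_of_ne _ hv, act_parent] at hw
    rcases vertex_cases (g.1 (cons i v)) with h | ⟨k, u, hu⟩
    · simp at h
    · rw [hu] at hw ⊢
      by_cases hur : u = root
      · subst hur
        exact absurd hw.symm (cons_ne_root j w)
      · rw [parent_cons_of_ne _ hur, cons_inj] at hw
        exact ⟨u, by rw [hw.1]⟩

/-- Removing the first letter of a vertex. -/
def tail (v : Vertex binary) : Vertex binary :=
  ⟨v.1.tail, fun i h => by
    have h' : i < v.1.length - 1 := by simpa using h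
    simpa using v.2 (i + 1) (by omega)⟩

@[simp] theorem tail_cons (i : Bool) (v : Vertex binary) : tail (cons i v) = v := rfl

theorem cons_tail_act {g : BinAut} {i j : Bool} (hg : g.1 (cons i root) = cons j root)
    (v : Vertex binary) : cons j (tail (g.1 (cons i v))) = g.1 (cons i v) := by
  obtain ⟨w, hw⟩ := exists_act_cons hg v
  rw [hw, tail_cons]

/-- The automorphism induced on the tree below the fixed vertex `i` of level one. -/
def sectionAt (g : BinAut) (i : Bool) (hg : g.1 (cons i root) = cons i root) : BinAut where
  val :=
    { toFun := fun v => tail (g.1 (cons i v))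
      invFun := fun v => tail ((g⁻¹).1 (cons i v))
      left_inv := fun v => by
        beta_reduce
        rw [cons_tail_act hg, inv_act_act, tail_cons]
      right_inv := fun v => by
        have hg' : (g⁻¹).1 (cons i root) = cons i root := by
          conv_lhs => rw [← hg]
          exact inv_act_act _ _
        beta_reduce
        rw [cons_tail_act hg', act_inv_act, tail_cons] }
  property := fun v => by
    by_cases hv : v = root
    · subst hv
      simp [hg]
    · change tail (g.1 (cons i v.parent)) = (tail (g.1 (cons i v))).parent
      rw [← parent_cons_of_ne _ hv, act_parent]
      obtain ⟨w, hw⟩ := exists_act_cons hg v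
      rw [hw, parent_cons_of_ne, tail_cons, tail_cons]
      rintro rfl
      rw [← hg] at hw
      exact hv ((cons_inj.1 (g.1.injective hw)).2)

theorem exists_pair {g : BinAut} (h0 : g.1 (cons false root) = cons false root)
    (h1 : g.1 (cons true root) = cons true root) : ∃ p q, g = pair p q :=
  ⟨sectionAt g false h0, sectionAt g true h1,
    binAut_ext' (fun v => (cons_tail_act h0 v).symm) (fun v => (cons_tail_act h1 v).symm)⟩

theorem act_level_one (g : BinAut) :
    (g.1 (cons false root) = cons false root ∧ g.1 (cons true root) = cons true root) ∨
    (g.1 (cons false root) = cons true root ∧ g.1 (cons true root) = cons false root) := by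
  have key : ∀ i, ∃ j, g.1 (cons i root) = cons j root := fun i => by
    have h : (g.1 (cons i root)).level = 0 + 1 := by simp
    obtain ⟨j, w, hw, h⟩ := level_eq_succ.1 h
    rw [level_eq_zero] at hw
    exact ⟨j, hw ▸ h⟩
  obtain ⟨j, hj⟩ := key false
  obtain ⟨k, hk⟩ := key true
  have hne : j ≠ k := by
    rintro rfl
    have := g.1.injective (hj.trans hk.symm)
    simp at this
  rcases j <;> rcases k <;> simp_all

/-! ### The generators -/

/-- The generator `a`. -/
abbrev ga : BinAut := grigorchukGenerator .a
/-- The generator `b`. -/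
abbrev gb : BinAut := grigorchukGenerator .b
/-- The generator `c`. -/
abbrev gc : BinAut := grigorchukGenerator .c
/-- The generator `d`. -/
abbrev gd : BinAut := grigorchukGenerator .d

@[simp] theorem ga_cons (i : Bool) (v : Vertex binary) : ga.1 (cons i v) = cons (!i) v := by
  cases i <;> rfl

theorem gb_eq : gb = pair ga gc := binAut_ext' (fun _ => rfl) (fun _ => rfl)
theorem gc_eq : gc = pair ga gd := binAut_ext' (fun _ => rfl) (fun _ => rfl)
theorem gd_eq : gd = pair 1 gb := binAut_ext' (fun _ => rfl) (fun _ => rfl)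

theorem generator_mul_self (s : GrigorchukGen) :
    grigorchukGenerator s * grigorchukGenerator s = 1 :=
  binAut_ext fun v => Subtype.ext (grigorchukAct_grigorchukAct s v.1)

@[simp] theorem generator_inv (s : GrigorchukGen) :
    (grigorchukGenerator s)⁻¹ = grigorchukGenerator s :=
  inv_eq_of_mul_eq_one_right (generator_mul_self s)

theorem ga_pair (g h : BinAut) : ga * pair g h = pair h g * ga :=
  binAut_ext' (fun v => by simp) (fun v => by simp)

theorem ga_pair_ga (g h : BinAut) : ga * pair g h * ga = pair h g := by
  rw [ga_pair, mul_assoc, generator_mul_self, mul_one]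

theorem exists_pair_or (g : BinAut) : ∃ p q, g = pair p q ∨ g = pair p q * ga := by
  rcases act_level_one g with ⟨h0, h1⟩ | ⟨h0, h1⟩
  · obtain ⟨p, q, h⟩ := exists_pair h0 h1
    exact ⟨p, q, Or.inl h⟩
  · obtain ⟨p, q, h⟩ := exists_pair (g := g * ga) (by simpa using h1) (by simpa using h0)
    exact ⟨p, q, Or.inr (by rw [← h, mul_assoc, generator_mul_self, mul_one])⟩

theorem pair_ne_pair_mul_ga (g h g' h' : BinAut) : pair g h ≠ pair g' h' * ga := fun H => by
  have := congrArg (fun k : BinAut => k.1 (cons false root)) H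
  simp at this

/-! ### Level stabilizers -/

/-- The pointwise stabilizer of level `n`. -/
def levelStab (n : ℕ) : Subgroup BinAut where
  carrier := {g | ∀ v : Vertex binary, v.level = n → g.1 v = v}
  one_mem' := fun _ _ => rfl
  mul_mem' := fun {g h} hg hh v hv => by rw [mul_act, hh v hv, hg v hv]
  inv_mem' := fun {g} hg v hv => by
    conv_lhs => rw [← hg v hv]
    exact inv_act_act _ _

theorem mem_levelStab {n : ℕ} {g : BinAut} :
    g ∈ levelStab n ↔ ∀ v : Vertex binary, v.level = n → g.1 v = v := Iff.rfl

instance levelStab_normal (n : ℕ) : (levelStab n).Normal where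
  conj_mem := fun g hg k v hv => by
    rw [mul_act, mul_act, hg _ (by rw [level_act, hv]), act_inv_act]

@[simp] theorem levelStab_zero : levelStab 0 = ⊤ := by
  refine eq_top_iff.2 fun g _ v hv => ?_
  rw [level_eq_zero] at hv
  rw [hv, act_root]

@[simp] theorem pair_mem_levelStab {n : ℕ} {g h : BinAut} :
    pair g h ∈ levelStab (n + 1) ↔ g ∈ levelStab n ∧ h ∈ levelStab n := by
  constructor
  · intro H
    exact ⟨fun v hv => by simpa using H (cons false v) (by simp [hv]),
      fun v hv => by simpa using H (cons true v) (by simp [hv])⟩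
  · rintro ⟨hg, hh⟩ v hv
    obtain ⟨_ | _, w, hw, rfl⟩ := level_eq_succ.1 hv
    · rw [pair_false, hg w hw]
    · rw [pair_true, hh w hw]

theorem levelStab_succ_le (n : ℕ) : levelStab (n + 1) ≤ levelStab n := fun g hg v hv => by
  have := hg (cons false v)
  obtain ⟨w, hw, hp⟩ : ∃ w : Vertex binary, w.level = n + 1 ∧ w.parent = v := by
    refine ⟨⟨v.1 ++ [0], fun i h => ?_⟩, ?_, ?_⟩
    · rcases Nat.lt_or_ge i v.1.length with h' | h'
      · rw [List.getElem_append_left h']; exact v.2 i h'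
      · rw [List.getElem_append_right h']; simp
    · simp only [Vertex.level, List.length_append, List.length_singleton] at hv ⊢
      omega
    · exact Subtype.ext (by simp [Vertex.parent])
  rw [← hp, act_parent, hg w hw]

theorem levelStab_antitone : Antitone levelStab := antitone_nat_of_succ_le levelStab_succ_le

theorem mem_levelStab_succ {n : ℕ} {g : BinAut} :
    g ∈ levelStab (n + 1) ↔ ∃ p ∈ levelStab n, ∃ q ∈ levelStab n, g = pair p q := by
  constructor
  · intro hg
    have h1 : g ∈ levelStab 1 := levelStab_antitone (Nat.le_add_left 1 n) hg
    obtain ⟨p, q, rfl⟩ := exists_pair (h1 (cons false root) rfl) (h1 (cons true root) rfl)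
    rw [pair_mem_levelStab] at hg
    exact ⟨p, hg.1, q, hg.2, rfl⟩
  · rintro ⟨p, hp, q, hq, rfl⟩
    exact pair_mem_levelStab.2 ⟨hp, hq⟩

theorem ga_notMem_levelStab (n : ℕ) : ga ∉ levelStab (n + 1) := fun h => by
  obtain ⟨p, -, q, -, h⟩ := mem_levelStab_succ.1 h
  exact pair_ne_pair_mul_ga p q 1 1 (by rw [← h, pair_one, one_mul])

theorem eq_one_of_forall_mem_levelStab {g : BinAut} (h : ∀ n, g ∈ levelStab n) : g = 1 :=
  binAut_ext fun v => h v.level v rfl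

theorem pow_mem_levelStab (n : ℕ) (g : BinAut) : g ^ 2 ^ n ∈ levelStab n := by
  induction n generalizing g with
  | zero => simp
  | succ n ih =>
    obtain ⟨p, q, h⟩ : ∃ p q, g ^ 2 = pair p q := by
      obtain ⟨p, q, rfl | rfl⟩ := exists_pair_or g
      · exact ⟨p ^ 2, q ^ 2, pair_pow _ _ _⟩
      · refine ⟨p * q, q * p, ?_⟩
        rw [pow_two, mul_assoc, ← mul_assoc ga, ga_pair_ga, pair_mul]
    rw [pow_succ', pow_mul, h, pair_pow, pair_mem_levelStab]
    exact ⟨ih p, ih q⟩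

/-! ### Automorphisms supported below a vertex, and products over a level -/

/-- The embedding of `Aut(T_2)` as the group of automorphisms supported below the vertex `i` of
level one. -/
def atLetter : Bool → BinAut →* BinAut
  | false => { toFun := fun g => pair g 1, map_one' := pair_one, map_mul' := by simp }
  | true => { toFun := fun g => pair 1 g, map_one' := pair_one, map_mul' := by simp }

@[simp] theorem atLetter_false (g : BinAut) : atLetter false g = pair g 1 := rfl
@[simp] theorem atLetter_true (g : BinAut) : atLetter true g = pair 1 g := rfl

/-- The embedding of `Aut(T_2)` as the group of automorphisms supported below the vertex with the
letters `l`. -/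
def atVertex : List Bool → BinAut →* BinAut
  | [] => MonoidHom.id _
  | i :: l => (atLetter i).comp (atVertex l)

@[simp] theorem atVertex_nil (g : BinAut) : atVertex [] g = g := rfl
@[simp] theorem atVertex_cons (i : Bool) (l : List Bool) (g : BinAut) :
    atVertex (i :: l) g = atLetter i (atVertex l g) := rfl

theorem atVertex_append (l l' : List Bool) (g : BinAut) :
    atVertex (l ++ l') g = atVertex l (atVertex l' g) := by
  induction l with
  | nil => rfl
  | cons i l ih => simp [ih]

theorem atLetter_injective (i : Bool) : Function.Injective (atLetter i) := by
  intro g h H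
  cases i <;> simpa using H

theorem atVertex_injective (l : List Bool) : Function.Injective (atVertex l) := by
  induction l with
  | nil => exact fun _ _ h => h
  | cons i l ih => exact (atLetter_injective i).comp ih

/-- The product over the vertices `l` of level `n` of the automorphisms `f l` of the subtrees; the
values of `f` at lists of another length play no role. -/
def levelProd : ℕ → (List Bool → BinAut) →* BinAut
  | 0 => Pi.evalMonoidHom _ []
  | n + 1 =>
    { toFun := fun f =>
        pair (levelProd n fun l => f (false :: l)) (levelProd n fun l => f (true :: l))
      map_one' := by
        rw [← pair_one]
        exact congrArg₂ pair (levelProd n).map_one (levelProd n).map_one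
      map_mul' := fun f g => by
        rw [pair_mul, ← map_mul, ← map_mul]
        rfl }

@[simp] theorem levelProd_zero (f : List Bool → BinAut) : levelProd 0 f = f [] := rfl
@[simp] theorem levelProd_succ (n : ℕ) (f : List Bool → BinAut) :
    levelProd (n + 1) f =
      pair (levelProd n fun l => f (false :: l)) (levelProd n fun l => f (true :: l)) := rfl

/-- A group of automorphisms is self-similar here if the sections of those of its elements that fix
level one pointwise belong to it again. -/
def IsSelfSimilar (Γ : Subgroup BinAut) : Prop :=
  ∀ p q, pair p q ∈ Γ → p ∈ Γ ∧ q ∈ Γ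

theorem IsSelfSimilar.exists_levelProd {Γ : Subgroup BinAut} (hΓ : IsSelfSimilar Γ) {n m : ℕ}
    {g : BinAut} (hg : g ∈ Γ) (hgn : g ∈ levelStab (n + m)) :
    ∃ f : List Bool → BinAut, (∀ l, f l ∈ Γ ⊓ levelStab m) ∧ levelProd n f = g := by
  induction n generalizing g with
  | zero => exact ⟨fun _ => g, fun _ => ⟨hg, by simpa using hgn⟩, rfl⟩
  | succ n ih =>
    rw [Nat.add_right_comm] at hgn
    obtain ⟨p, hp, q, hq, rfl⟩ := mem_levelStab_succ.1 hgn
    obtain ⟨hp', hq'⟩ := hΓ p q hg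
    obtain ⟨f, hf, rfl⟩ := ih hp' hp
    obtain ⟨f', hf', rfl⟩ := ih hq' hq
    refine ⟨fun l => match l with
      | [] => 1
      | false :: l => f l
      | true :: l => f' l, fun l => ?_, rfl⟩
    rcases l with _ | ⟨_ | _, l⟩
    · exact one_mem _
    · exact hf l
    · exact hf' l

theorem isSelfSimilar_top : IsSelfSimilar ⊤ := fun _ _ _ => ⟨trivial, trivial⟩

theorem IsSelfSimilar.of_atVertex {Γ : Subgroup BinAut} (hΓ : IsSelfSimilar Γ) {l : List Bool}
    {g : BinAut} (hg : atVertex l g ∈ Γ) : g ∈ Γ := by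
  induction l with
  | nil => exact hg
  | cons i l ih =>
    rcases i with _ | _
    · exact ih (hΓ _ _ hg).1
    · exact ih (hΓ _ _ hg).2

theorem atVertex_mem {κ : Subgroup BinAut} (hκ : ∀ i, ∀ k ∈ κ, atLetter i k ∈ κ) (l : List Bool)
    {k : BinAut} (hk : k ∈ κ) : atVertex l k ∈ κ := by
  induction l with
  | nil => exact hk
  | cons i l ih => exact hκ i _ ih

theorem atVertex_mem_levelStab {n : ℕ} {l : List Bool} {g : BinAut} (hg : g ∈ levelStab n) :
    atVertex l g ∈ levelStab (l.length + n) := by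
  induction l with
  | nil => simpa using hg
  | cons i l ih =>
    rw [List.length_cons, Nat.add_right_comm]
    rcases i with _ | _
    · exact pair_mem_levelStab.2 ⟨ih, one_mem _⟩
    · exact pair_mem_levelStab.2 ⟨one_mem _, ih⟩

theorem levelProd_mem_levelStab {n m : ℕ} {f : List Bool → BinAut}
    (hf : ∀ l, f l ∈ levelStab m) : levelProd n f ∈ levelStab (n + m) := by
  induction n generalizing f with
  | zero => simpa using hf []
  | succ n ih =>
    rw [Nat.add_right_comm]
    exact pair_mem_levelStab.2 ⟨ih fun l => hf _, ih fun l => hf _⟩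

theorem atVertex_levelProd (p : List Bool) (n : ℕ) (f : List Bool → BinAut) :
    atVertex p (levelProd (n + 1) f) =
      atVertex (p ++ [false]) (levelProd n fun l => f (false :: l)) *
        atVertex (p ++ [true]) (levelProd n fun l => f (true :: l)) := by
  rw [atVertex_append, atVertex_append, ← map_mul]
  simp

theorem levelProd_mem_aux {H : Subgroup BinAut} (n : ℕ) (p : List Bool) (f : List Bool → BinAut)
    (hf : ∀ l : List Bool, l.length = n → atVertex (p ++ l) (f l) ∈ H) :
    atVertex p (levelProd n f) ∈ H := by
  induction n generalizing p f with
  | zero => simpa using hf [] rfl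
  | succ n ih =>
    rw [atVertex_levelProd]
    refine mul_mem (ih _ _ fun l hl => ?_) (ih _ _ fun l hl => ?_)
    · simpa using hf (false :: l) (by simp [hl])
    · simpa using hf (true :: l) (by simp [hl])

theorem levelProd_mem {H : Subgroup BinAut} {n : ℕ} {f : List Bool → BinAut}
    (hf : ∀ l : List Bool, l.length = n → atVertex l (f l) ∈ H) : levelProd n f ∈ H :=
  levelProd_mem_aux n [] f hf

theorem levelProd_mem_pow_aux {B : Set BinAut} {k : ℕ} (n : ℕ) (p : List Bool)
    (f : List Bool → BinAut)
    (hf : ∀ l : List Bool, l.length = n → atVertex (p ++ l) (f l) ∈ B ^ k) :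
    atVertex p (levelProd n f) ∈ B ^ (k * 2 ^ n) := by
  induction n generalizing p f with
  | zero => simpa using hf [] rfl
  | succ n ih =>
    rw [atVertex_levelProd, pow_succ 2 n, mul_two, mul_add, pow_add]
    refine Set.mul_mem_mul (ih _ _ fun l hl => ?_) (ih _ _ fun l hl => ?_)
    · simpa using hf (false :: l) (by simp [hl])
    · simpa using hf (true :: l) (by simp [hl])

theorem levelProd_mem_pow {B : Set BinAut} {k n : ℕ} {f : List Bool → BinAut}
    (hf : ∀ l : List Bool, l.length = n → atVertex l (f l) ∈ B ^ k) :
    levelProd n f ∈ B ^ (k * 2 ^ n) :=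
  levelProd_mem_pow_aux n [] f hf

theorem levelProd_conj_atVertex (l : List Bool) (f : List Bool → BinAut) (g : BinAut) :
    levelProd l.length f * atVertex l g * (levelProd l.length f)⁻¹ =
      atVertex l (f l * g * (f l)⁻¹) := by
  induction l generalizing f with
  | nil => rfl
  | cons i l ih =>
    rcases i with _ | _
    · simpa using ih fun l => f (false :: l)
    · simpa using ih fun l => f (true :: l)

/-- The vertex with the letters `l`. -/
def vertexOf : List Bool → Vertex binary
  | [] => root
  | i :: l => cons i (vertexOf l)

@[simp] theorem level_vertexOf (l : List Bool) : (vertexOf l).level = l.length := by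
  induction l with
  | nil => rfl
  | cons i l ih => simp [vertexOf, ih]

theorem exists_vertexOf (v : Vertex binary) : ∃ l, vertexOf l = v := by
  induction v using vertex_induction with
  | hr => exact ⟨[], rfl⟩
  | hc i v ih =>
    obtain ⟨l, rfl⟩ := ih
    exact ⟨i :: l, rfl⟩

theorem fixes_not_below_iff {l : List Bool} {g : BinAut} :
    (∀ w, ¬ (vertexOf l).Below w → g.1 w = w) ↔ ∃ h, g = atVertex l h := by
  induction l generalizing g with
  | nil => exact ⟨fun _ => ⟨g, rfl⟩, fun _ w hw => absurd (below_root w) hw⟩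
  | cons i l ih =>
    constructor
    · intro H
      have hfix : g.1 (cons (!i) root) = cons (!i) root := H _ (by simp [vertexOf])
      obtain ⟨h0, h1⟩ : g.1 (cons false root) = cons false root ∧
          g.1 (cons true root) = cons true root := by
        rcases act_level_one g with h | h
        · exact h
        · cases i <;> simp [h.1, h.2] at hfix
      obtain ⟨p, q, rfl⟩ := exists_pair h0 h1
      rcases i with _ | _
      · have hq : q = 1 := binAut_ext fun v => by simpa [vertexOf] using H (cons true v)
        obtain ⟨h, rfl⟩ := (ih (g := p)).1 fun w hw => by
          simpa [vertexOf, hw] using H (cons false w)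
        exact ⟨h, by rw [hq]; rfl⟩
      · have hq : p = 1 := binAut_ext fun v => by simpa [vertexOf] using H (cons false v)
        obtain ⟨h, rfl⟩ := (ih (g := q)).1 fun w hw => by
          simpa [vertexOf, hw] using H (cons true w)
        exact ⟨h, by rw [hq]; rfl⟩
    · rintro ⟨h, rfl⟩ w hw
      rcases vertex_cases w with rfl | ⟨j, w, rfl⟩
      · exact act_root _
      · have h2 := (ih (g := atVertex l h)).2 ⟨h, rfl⟩ w
        simp only [vertexOf, cons_below_cons, not_and] at hw
        rcases i with _ | _ <;> rcases j with _ | _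
        · simpa using h2 (hw rfl)
        · simp
        · simp
        · simpa using h2 (hw rfl)

/-! ### The topology of `Aut(T_2)` -/

theorem isOpen_stab (v w : Vertex binary) : IsOpen {g : BinAut | g.1 v = w} := by
  let : TopologicalSpace (Vertex binary) := ⊥
  have : DiscreteTopology (Vertex binary) := ⟨rfl⟩
  have : Continuous fun g : BinAut => g.1 v :=
    (continuous_apply v).comp (continuous_induced_dom (f := fun g : BinAut => (g.1 : _ → _)))
  exact (isOpen_discrete {w}).preimage this

theorem continuous_of_isOpen_stab {X : Type*} [TopologicalSpace X] {F : X → BinAut}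
    (hF : ∀ v w, IsOpen {x | (F x).1 v = w}) : Continuous F := by
  let : TopologicalSpace (Vertex binary) := ⊥
  have : DiscreteTopology (Vertex binary) := ⟨rfl⟩
  refine continuous_induced_rng.2 (continuous_pi fun v => continuous_discrete_rng.2 fun w => ?_)
  exact hF v w

instance : IsTopologicalGroup BinAut where
  continuous_mul := continuous_of_isOpen_stab fun v w => by
    have : {x : BinAut × BinAut | (x.1 * x.2).1 v = w} =
        ⋃ u, {g : BinAut | g.1 u = w} ×ˢ {h : BinAut | h.1 v = u} := by
      ext ⟨g, h⟩
      simp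
    rw [this]
    exact isOpen_iUnion fun u => (isOpen_stab u w).prod (isOpen_stab v u)
  continuous_inv := continuous_of_isOpen_stab fun v w => by
    have : {x : BinAut | (x⁻¹).1 v = w} = {g : BinAut | g.1 w = v} := by
      ext g
      constructor
      · rintro rfl; exact act_inv_act g v
      · rintro rfl; exact inv_act_act g w
    rw [this]
    exact isOpen_stab w v

instance : T2Space BinAut := by
  let : TopologicalSpace (Vertex binary) := ⊥
  have : DiscreteTopology (Vertex binary) := ⟨rfl⟩
  exact T2Space.of_injective_continuous
    (f := fun g : BinAut => (g.1 : Vertex binary → Vertex binary))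
    (fun g h H => binAut_ext fun v => congrFun H v) continuous_induced_dom

theorem finite_level (n : ℕ) : {v : Vertex binary | v.level = n}.Finite := by
  induction n with
  | zero => exact (Set.finite_singleton root).subset fun v hv => level_eq_zero.1 hv
  | succ n ih =>
    refine ((ih.image (cons false)).union (ih.image (cons true))).subset fun v hv => ?_
    obtain ⟨_ | _, w, hw, rfl⟩ := level_eq_succ.1 hv
    · exact Or.inl ⟨w, hw, rfl⟩
    · exact Or.inr ⟨w, hw, rfl⟩

instance : CompactSpace BinAut := by
  let : TopologicalSpace (Vertex binary) := ⊥
  have : DiscreteTopology (Vertex binary) := ⟨rfl⟩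
  let ι : BinAut → (Vertex binary → Vertex binary) := fun g => g.1
  have hι : IsInducing ι := ⟨rfl⟩
  refine ⟨hι.isCompact_iff.2 ?_⟩
  -- the image consists of the level-preserving injections that commute with `parent`
  have himage : ι '' Set.univ = (Set.univ.pi fun v => {w | w.level = v.level}) ∩
      ((⋂ v, {f | f v.parent = (f v).parent}) ∩ ⋂ v, ⋂ w, {f | f v = f w → v = w}) := by
    ext f
    constructor
    · rintro ⟨g, -, rfl⟩
      refine ⟨fun v _ => level_act g v, Set.mem_iInter.2 fun v => act_parent g v,
        Set.mem_iInter₂.2 fun v w h => g.1.injective h⟩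
    · rintro ⟨hl, hp, hi⟩
      simp only [Set.mem_pi, Set.mem_univ, Set.mem_ofPred_eq, forall_const, Set.mem_iInter]
        at hl hp hi
      have hinj : Function.Injective f := fun v w h => hi v w h
      have hsurj : Function.Surjective f := fun w => by
        have hm : Set.MapsTo f {v | v.level = w.level} {v | v.level = w.level} :=
          fun v hv => (hl v).trans hv
        have hsub : f '' {v | v.level = w.level} ⊆ {v | v.level = w.level} := hm.image_subset
        have himg := Set.eq_of_subset_of_ncard_le hsub (Set.ncard_image_of_injective _ hinj).ge
          (finite_level _)
        obtain ⟨v, -, hv⟩ := himg.ge (show w ∈ {v : Vertex binary | v.level = w.level} from rfl)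
        exact ⟨v, hv⟩
      exact ⟨⟨Equiv.ofBijective f ⟨hinj, hsurj⟩, hp⟩, trivial, rfl⟩
  rw [himage]
  refine (isCompact_univ_pi fun v : Vertex binary => (finite_level v.level).isCompact).inter_right
    (IsClosed.inter (isClosed_iInter fun v => ?_)
      (isClosed_iInter fun v => isClosed_iInter fun w => ?_))
  · exact isClosed_eq (continuous_apply _)
      ((continuous_of_discreteTopology (f := Vertex.parent)).comp (continuous_apply v))
  · by_cases hvw : v = w
    · simp [hvw]
    · simp only [hvw, imp_false]
      have hc : Continuous fun f : Vertex binary → Vertex binary => (f v, f w) :=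
        (continuous_apply v).prodMk (continuous_apply w)
      exact (isClosed_discrete {p : Vertex binary × Vertex binary | ¬ p.1 = p.2}).preimage hc

theorem isOpen_levelStab (n : ℕ) : IsOpen (levelStab n : Set BinAut) := by
  have : (levelStab n : Set BinAut) = ⋂ v ∈ {v : Vertex binary | v.level = n}, {g | g.1 v = v} := by
    ext g
    simp [mem_levelStab]
  rw [this]
  exact (finite_level n).isOpen_biInter fun v _ => isOpen_stab v v

theorem nhds_one_hasBasis : (𝓝 (1 : BinAut)).HasBasis (fun _ => True) fun n =>
    (levelStab n : Set BinAut) := by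
  let : TopologicalSpace (Vertex binary) := ⊥
  have : DiscreteTopology (Vertex binary) := ⟨rfl⟩
  refine ⟨fun U => ⟨fun hU => ?_, fun ⟨n, _, hn⟩ =>
    Filter.mem_of_superset ((isOpen_levelStab n).mem_nhds (one_mem _)) hn⟩⟩
  by_contra! H
  -- otherwise the compact sets `levelStab n \ interior U` would have a common point
  have hne : (⋂ n, ((levelStab n : Set BinAut) ∩ (interior U)ᶜ)).Nonempty := by
    have hcl : ∀ n, IsClosed ((levelStab n : Set BinAut) ∩ (interior U)ᶜ) := fun n =>
      ((levelStab n).isClosed_of_isOpen (isOpen_levelStab n)).inter isOpen_interior.isClosed_compl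
    refine IsCompact.nonempty_iInter_of_sequence_nonempty_isCompact_isClosed _
      (fun n => Set.inter_subset_inter_left _ (levelStab_succ_le n)) (fun n => ?_)
      (hcl 0).isCompact hcl
    obtain ⟨g, hg, hgU⟩ := Set.not_subset.1 (H n trivial)
    exact ⟨g, hg, fun h => hgU (interior_subset h)⟩
  obtain ⟨g, hg⟩ := hne
  rw [Set.mem_iInter] at hg
  have : g = 1 := eq_one_of_forall_mem_levelStab fun n => (hg n).1
  subst this
  exact (hg 0).2 (mem_interior_iff_mem_nhds.2 hU)

theorem mem_closure_iff_levelStab {S : Set BinAut} {g : BinAut} :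
    g ∈ closure S ↔ ∀ n, ∃ s ∈ S, s⁻¹ * g ∈ levelStab n := by
  constructor
  · intro hg n
    have ho : IsOpen {s : BinAut | s⁻¹ * g ∈ levelStab n} :=
      (isOpen_levelStab n).preimage (by fun_prop : Continuous fun s : BinAut => s⁻¹ * g)
    obtain ⟨s, hs, hsS⟩ := mem_closure_iff.1 hg _ ho (by simp)
    exact ⟨s, hsS, hs⟩
  · intro H
    rw [mem_closure_iff_nhds]
    intro U hU
    have : (fun h : BinAut => g * h⁻¹) ⁻¹' U ∈ 𝓝 1 := by
      have hc : ContinuousAt (fun h : BinAut => g * h⁻¹) 1 := by fun_prop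
      exact hc (by simpa using hU)
    obtain ⟨n, -, hn⟩ := nhds_one_hasBasis.mem_iff.1 this
    obtain ⟨s, hs, hsg⟩ := H n
    refine ⟨s, ?_, hs⟩
    simpa using hn hsg

instance : TotallyDisconnectedSpace BinAut := by
  let : TopologicalSpace (Vertex binary) := ⊥
  have : DiscreteTopology (Vertex binary) := ⟨rfl⟩
  have : IsEmbedding (fun g : BinAut => (g.1 : Vertex binary → Vertex binary)) :=
    ⟨⟨rfl⟩, fun g h H => binAut_ext fun v => congrFun H v⟩
  exact ⟨this.isTotallyDisconnected (isTotallyDisconnected_of_totallyDisconnectedSpace _)⟩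

instance (n : ℕ) : Finite (BinAut ⧸ levelStab n) :=
  Subgroup.quotient_finite_of_isOpen _ (isOpen_levelStab n)

/-! ### Relations in the Grigorchuk group -/

/-- The generators `b`, `c`, `d` satisfy the relations of the Klein four-group. The three relations
are proved together, as each one at a vertex `1v` is another one at `v`. -/
theorem klein_relations (v : Vertex binary) :
    gb.1 (gc.1 v) = gd.1 v ∧ gc.1 (gd.1 v) = gb.1 v ∧ gd.1 (gb.1 v) = gc.1 v := by
  have haa : ∀ w, ga.1 (ga.1 w) = w := fun w => by
    rw [← mul_act, generator_mul_self, one_act]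
  induction v using vertex_induction with
  | hr => simp
  | hc i v ih =>
    rcases i with _ | _
    · exact ⟨congrArg (cons false) (haa v), rfl, rfl⟩
    · exact ⟨congrArg (cons true) ih.2.1, congrArg (cons true) ih.2.2, congrArg (cons true) ih.1⟩

@[simp] theorem ga_mul_ga : ga * ga = 1 := generator_mul_self _
@[simp] theorem gb_mul_gb : gb * gb = 1 := generator_mul_self _
@[simp] theorem gc_mul_gc : gc * gc = 1 := generator_mul_self _
@[simp] theorem gd_mul_gd : gd * gd = 1 := generator_mul_self _
@[simp] theorem gb_mul_gc : gb * gc = gd := binAut_ext fun v => (klein_relations v).1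
@[simp] theorem gc_mul_gd : gc * gd = gb := binAut_ext fun v => (klein_relations v).2.1
@[simp] theorem gd_mul_gb : gd * gb = gc := binAut_ext fun v => (klein_relations v).2.2
@[simp] theorem gc_mul_gb : gc * gb = gd := by
  simpa only [mul_inv_rev, generator_inv] using congrArg (·⁻¹) gb_mul_gc
@[simp] theorem gd_mul_gc : gd * gc = gb := by
  simpa only [mul_inv_rev, generator_inv] using congrArg (·⁻¹) gc_mul_gd
@[simp] theorem gb_mul_gd : gb * gd = gc := by
  simpa only [mul_inv_rev, generator_inv] using congrArg (·⁻¹) gd_mul_gb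
@[simp] theorem ga_mul_ga_mul (w : BinAut) : ga * (ga * w) = w := by simp [← mul_assoc]
@[simp] theorem gb_mul_gb_mul (w : BinAut) : gb * (gb * w) = w := by simp [← mul_assoc]
@[simp] theorem gd_mul_gd_mul (w : BinAut) : gd * (gd * w) = w := by simp [← mul_assoc]
@[simp] theorem gb_mul_gc_mul (w : BinAut) : gb * (gc * w) = gd * w := by simp [← mul_assoc]
@[simp] theorem gd_mul_gb_mul (w : BinAut) : gd * (gb * w) = gc * w := by simp [← mul_assoc]
@[simp] theorem gc_mul_gb_mul (w : BinAut) : gc * (gb * w) = gd * w := by simp [← mul_assoc]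
@[simp] theorem gd_mul_gc_mul (w : BinAut) : gd * (gc * w) = gb * w := by simp [← mul_assoc]
@[simp] theorem gb_mul_gd_mul (w : BinAut) : gb * (gd * w) = gc * w := by simp [← mul_assoc]

theorem ga_gd_ga : ga * gd * ga = pair gb 1 := by rw [gd_eq, ga_pair_ga]

/-! ### Self-similarity and transitivity -/

@[simp] theorem generator_mem (s : GrigorchukGen) : grigorchukGenerator s ∈ grigorchukGroup :=
  Subgroup.subset_closure ⟨s, rfl⟩

@[elab_as_elim]
theorem grigorchuk_induction {P : ∀ g, g ∈ grigorchukGroup → Prop} (h1 : P 1 (one_mem _))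
    (hmul : ∀ s, ∀ g, ∀ hg : g ∈ grigorchukGroup, P g hg →
      P (grigorchukGenerator s * g) (mul_mem (Subgroup.subset_closure ⟨s, rfl⟩) hg))
    {g : BinAut} (hg : g ∈ grigorchukGroup) : P g hg := by
  induction hg using Subgroup.closure_induction_left with
  | one => exact h1
  | mul_left x hx y hy ih =>
    obtain ⟨s, rfl⟩ := hx
    exact hmul s y hy ih
  | inv_mul_cancel x hx y hy ih =>
    obtain ⟨s, rfl⟩ := hx
    simp only [generator_inv]
    exact hmul s y hy ih

theorem grigorchuk_le {H : Subgroup BinAut} (h : ∀ s, grigorchukGenerator s ∈ H) :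
    grigorchukGroup ≤ H := by
  rw [grigorchukGroup, Subgroup.closure_le]
  rintro _ ⟨s, rfl⟩
  exact h s

theorem grigorchuk_exists_pair_or {g : BinAut} (hg : g ∈ grigorchukGroup) :
    ∃ p ∈ grigorchukGroup, ∃ q ∈ grigorchukGroup, g = pair p q ∨ g = pair p q * ga := by
  induction hg using grigorchuk_induction with
  | h1 => exact ⟨1, one_mem _, 1, one_mem _, Or.inl pair_one.symm⟩
  | hmul s g hg ih =>
    obtain ⟨p, hp, q, hq, h⟩ := ih
    have key : ∀ u ∈ grigorchukGroup, ∀ w ∈ grigorchukGroup,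
        ∃ p ∈ grigorchukGroup, ∃ q ∈ grigorchukGroup,
          pair u w * g = pair p q ∨ pair u w * g = pair p q * ga := fun u hu w hw =>
      ⟨u * p, mul_mem hu hp, w * q, mul_mem hw hq, by
        rcases h with rfl | rfl
        · exact Or.inl (pair_mul ..)
        · exact Or.inr (by rw [← mul_assoc, pair_mul])⟩
    rcases s with _ | _ | _ | _
    · refine ⟨q, hq, p, hp, ?_⟩
      rcases h with rfl | rfl
      · exact Or.inr (ga_pair p q)
      · exact Or.inl (by rw [← mul_assoc, ga_pair_ga])
    · rw [show grigorchukGenerator .b = pair ga gc from gb_eq]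
      exact key _ (generator_mem _) _ (generator_mem _)
    · rw [show grigorchukGenerator .c = pair ga gd from gc_eq]
      exact key _ (generator_mem _) _ (generator_mem _)
    · rw [show grigorchukGenerator .d = pair 1 gb from gd_eq]
      exact key _ (one_mem _) _ (generator_mem _)

theorem isSelfSimilar_grigorchuk : IsSelfSimilar grigorchukGroup := fun p q h => by
  obtain ⟨p', hp, q', hq, h' | h'⟩ := grigorchuk_exists_pair_or h
  · obtain ⟨rfl, rfl⟩ := pair_inj.1 h'
    exact ⟨hp, hq⟩
  · exact absurd h' (pair_ne_pair_mul_ga _ _ _ _)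

/-- Every element of the Grigorchuk group is the section at `0` of an element of the group that
fixes level one. -/
theorem exists_pair_mem {g : BinAut} (hg : g ∈ grigorchukGroup) :
    ∃ h ∈ grigorchukGroup, pair g h ∈ grigorchukGroup := by
  induction hg using grigorchuk_induction with
  | h1 => exact ⟨1, one_mem _, by simp [one_mem]⟩
  | hmul s g hg ih =>
    obtain ⟨h, hh, hgh⟩ := ih
    have key : ∀ u w, pair u w ∈ grigorchukGroup → w ∈ grigorchukGroup →
        ∃ h ∈ grigorchukGroup, pair (u * g) h ∈ grigorchukGroup := fun u w h1 h2 =>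
      ⟨w * h, mul_mem h2 hh, by rw [← pair_mul]; exact mul_mem h1 hgh⟩
    have hconj : ∀ u w, pair u w ∈ grigorchukGroup → pair w u ∈ grigorchukGroup := fun u w h => by
      rw [← ga_pair_ga]
      exact mul_mem (mul_mem (generator_mem _) h) (generator_mem _)
    rcases s with _ | _ | _ | _
    · exact key _ gc (by rw [← gb_eq]; exact generator_mem _) (generator_mem _)
    · exact key _ 1 (hconj _ _ (by rw [← gd_eq]; exact generator_mem _)) (one_mem _)
    · exact key _ ga (hconj _ _ (by rw [← gb_eq]; exact generator_mem _)) (generator_mem _)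
    · exact key _ ga (hconj _ _ (by rw [← gc_eq]; exact generator_mem _)) (generator_mem _)

/-- `t` moves the vertex `l` to the vertex `l'`, and induces `s` between the two subtrees; this is
expressed by conjugation of the automorphisms supported below `l`. -/
def Carries (l l' : List Bool) (t s : BinAut) : Prop :=
  ∀ k, t * atVertex l k * t⁻¹ = atVertex l' (s * k * s⁻¹)

theorem Carries.mul {l l' l'' : List Bool} {t s t' s' : BinAut} (h' : Carries l' l'' t' s')
    (h : Carries l l' t s) : Carries l l'' (t' * t) (s' * s) := by
  intro k
  have : t' * t * atVertex l k * (t' * t)⁻¹ = t' * (t * atVertex l k * t⁻¹) * t'⁻¹ := by group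
  rw [this, h, h']
  simp only [mul_inv_rev, mul_assoc]

theorem Carries.inv {l l' : List Bool} {t s : BinAut} (h : Carries l l' t s) :
    Carries l' l t⁻¹ s⁻¹ := fun k => by
  have := h (s⁻¹ * k * s)
  have h2 : s * (s⁻¹ * k * s) * s⁻¹ = k := by group
  rw [h2] at this
  rw [← this]
  group

theorem exists_carries {l l' : List Bool} (hl : l.length = l'.length) {s : BinAut}
    (hs : s ∈ grigorchukGroup) : ∃ t ∈ grigorchukGroup, Carries l l' t s := by
  induction l generalizing l' with
  | nil =>
    obtain rfl : l' = [] := List.length_eq_zero_iff.1 hl.symm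
    exact ⟨s, hs, fun k => rfl⟩
  | cons i l ih =>
    obtain _ | ⟨j, l'⟩ := l'
    · simp at hl
    obtain ⟨t, ht, htc⟩ := ih (by simpa using hl)
    obtain ⟨h, hh, hth⟩ := exists_pair_mem ht
    have h0 : Carries (false :: l) (false :: l') (pair t h) s := fun k => by
      simpa using htc k
    have ha : ∀ m b, Carries (b :: m) ((!b) :: m) ga 1 := fun m b k => by
      cases b <;> simp [ga_pair_ga]
    have hga : ga ∈ grigorchukGroup := generator_mem _
    rcases i with _ | _ <;> rcases j with _ | _
    · exact ⟨_, hth, h0⟩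
    · exact ⟨_, mul_mem hga hth, by simpa using (ha l' false).mul h0⟩
    · exact ⟨_, mul_mem hth hga, by simpa using h0.mul (ha l true)⟩
    · exact ⟨_, mul_mem hga (mul_mem hth hga),
        by simpa using (ha l' false).mul (h0.mul (ha l true))⟩

theorem grigorchuk_transitive (v w : Vertex binary) (h : v.level = w.level) :
    ∃ g ∈ grigorchukGroup, g.1 v = w := by
  induction v using vertex_induction generalizing w with
  | hr => exact ⟨1, one_mem _, by rw [level_root, eq_comm, level_eq_zero] at h; simp [h]⟩
  | hc i v ih =>
    rcases vertex_cases w with rfl | ⟨j, w, rfl⟩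
    · simp at h
    obtain ⟨g, hg, rfl⟩ := ih w (by simpa using h)
    obtain ⟨k, hk, hgk⟩ := exists_pair_mem hg
    have hga : ga ∈ grigorchukGroup := generator_mem _
    rcases i with _ | _ <;> rcases j with _ | _
    · exact ⟨_, hgk, by simp⟩
    · exact ⟨_, mul_mem hga hgk, by simp⟩
    · exact ⟨_, mul_mem hgk hga, by simp⟩
    · exact ⟨_, mul_mem hga (mul_mem hgk hga), by simp⟩

/-! ### The branching subgroup -/

/-- The element `(ab)²`. -/
def gx : BinAut := ga * gb * ga * gb

theorem gx_eq : gx = pair (gc * ga) (ga * gc) := by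
  rw [gx]
  conv_lhs => rw [gb_eq]
  rw [ga_pair_ga, pair_mul]

theorem gx_mem_grigorchuk : gx ∈ grigorchukGroup :=
  mul_mem (mul_mem (mul_mem (generator_mem _) (generator_mem _)) (generator_mem _))
    (generator_mem _)

/-- The normal closure `K` of `(ab)²` in the Grigorchuk group, over which the group is regular
branch. -/
def grigK : Subgroup BinAut :=
  Subgroup.closure {y | ∃ g ∈ grigorchukGroup, y = g * gx * g⁻¹}

theorem gx_mem : gx ∈ grigK := Subgroup.subset_closure ⟨1, one_mem _, by simp⟩

theorem grigK_le : grigK ≤ grigorchukGroup := by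
  rw [grigK, Subgroup.closure_le]
  rintro _ ⟨g, hg, rfl⟩
  exact mul_mem (mul_mem hg gx_mem_grigorchuk) (inv_mem hg)

theorem grigK_le_of {H : Subgroup BinAut} (h : ∀ g ∈ grigorchukGroup, g * gx * g⁻¹ ∈ H) :
    grigK ≤ H := by
  rw [grigK, Subgroup.closure_le]
  rintro _ ⟨g, hg, rfl⟩
  exact h g hg

theorem grigK_conj {g k : BinAut} (hg : g ∈ grigorchukGroup) (hk : k ∈ grigK) :
    g * k * g⁻¹ ∈ grigK := by
  have : grigK ≤ grigK.comap (MulAut.conj g).toMonoidHom := grigK_le_of fun h hh =>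
    Subgroup.subset_closure ⟨g * h, mul_mem hg hh, by simp [mul_assoc]⟩
  exact this hk

theorem commutator_mem_conj {g m : BinAut} (hg : g ∈ grigorchukGroup)
    (hm : m ∈ ⁅grigK, grigorchukGroup⁆) : g * m * g⁻¹ ∈ ⁅grigK, grigorchukGroup⁆ := by
  have : ⁅grigK, grigorchukGroup⁆ ≤
      (⁅grigK, grigorchukGroup⁆).comap (MulAut.conj g).toMonoidHom := by
    rw [Subgroup.commutator_le]
    intro k hk h hh
    change g * ⁅k, h⁆ * g⁻¹ ∈ ⁅grigK, grigorchukGroup⁆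
    rw [conjugate_commutatorElement]
    exact Subgroup.commutator_mem_commutator (grigK_conj hg hk)
      (mul_mem (mul_mem hg hh) (inv_mem hg))
  exact this hm

theorem commutator_grigK_le : ⁅grigK, grigorchukGroup⁆ ≤ grigK := by
  rw [Subgroup.commutator_le]
  intro k hk h hh
  have := mul_mem hk (grigK_conj hh (inv_mem hk))
  simpa [commutatorElement_def, mul_assoc] using this

theorem pair_gx_one_mem : pair gx 1 ∈ ⁅grigK, grigorchukGroup⁆ := by
  have hy : gb * ga * gb * ga ∈ grigK := by
    have := inv_mem gx_mem
    simpa [gx, mul_assoc] using this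
  set y := gb * ga * gb * ga with hydef
  have hga : ga ∈ grigorchukGroup := generator_mem _
  have hgd : gd ∈ grigorchukGroup := generator_mem _
  have hpair : pair gx 1 = (gb * ga * gd * ga) * (gb * ga * gd * ga) := by
    have h1 : gb * ga * gd * ga = pair (ga * gb) gc := by
      rw [mul_assoc, mul_assoc, ← mul_assoc ga, ga_gd_ga]
      nth_rewrite 1 [gb_eq]
      rw [pair_mul, mul_one]
    rw [h1, pair_mul, gc_mul_gc, gx]
    simp only [mul_assoc]
  -- `a` inverts `y`, so `⁅y, a⁆ = y²`, and the product below is `y · (ad) y (ad)⁻¹`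
  have h2 : pair gx 1 = (y * ⁅y, ga * gd⁆⁻¹ * y⁻¹) * ⁅y, ga⁆ := by
    rw [hpair]
    simp [hydef, commutatorElement_def, mul_assoc]
  rw [h2]
  exact mul_mem
    (commutator_mem_conj (grigK_le hy)
      (inv_mem (Subgroup.commutator_mem_commutator hy (mul_mem hga hgd))))
    (Subgroup.commutator_mem_commutator hy hga)

/-- The group `K × 1` is contained in `[K, G]`. -/
theorem atLetter_mem_commutator (i : Bool) {k : BinAut} (hk : k ∈ grigK) :
    atLetter i k ∈ ⁅grigK, grigorchukGroup⁆ := by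
  have h0 : grigK ≤ (⁅grigK, grigorchukGroup⁆).comap (atLetter false) := grigK_le_of fun g hg => by
    obtain ⟨h, hh, hgh⟩ := exists_pair_mem hg
    have := commutator_mem_conj hgh pair_gx_one_mem
    simpa using this
  rcases i with _ | _
  · exact h0 hk
  · have := commutator_mem_conj (generator_mem .a) (h0 hk)
    simpa [ga_pair_ga] using this

theorem atLetter_mem_grigK (i : Bool) {k : BinAut} (hk : k ∈ grigK) : atLetter i k ∈ grigK :=
  commutator_grigK_le (atLetter_mem_commutator i hk)

/-! ### The branching subgroup is a congruence subgroup -/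

open Classical in
/-- The sign of the permutation of level one. -/
noncomputable def rootSign : BinAut →* ℤˣ where
  toFun g := if g ∈ levelStab 1 then 1 else -1
  map_one' := by simp [one_mem]
  map_mul' g h := by
    have h0 : ∀ p q, pair p q ∈ levelStab 1 := fun p q => by
      rw [← zero_add 1, pair_mem_levelStab]; simp
    have h1 : ∀ p q, pair p q * ga ∉ levelStab 1 := fun p q H =>
      ga_notMem_levelStab 0 (((levelStab 1).mul_mem_cancel_left (h0 p q)).1 H)
    obtain ⟨p, q, rfl | rfl⟩ := exists_pair_or g <;> obtain ⟨p', q', rfl | rfl⟩ := exists_pair_or h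
    · simp [h0]
    · rw [← mul_assoc, pair_mul]; simp [h0, h1]
    · rw [mul_assoc, ga_pair, ← mul_assoc, pair_mul]; simp [h0, h1]
    · rw [mul_assoc, ← mul_assoc ga, ga_pair_ga, pair_mul]; simp [h0, h1]

@[simp] theorem rootSign_pair (p q : BinAut) : rootSign (pair p q) = 1 := by
  have : pair p q ∈ levelStab 1 := by rw [← zero_add 1, pair_mem_levelStab]; simp
  simp [rootSign, this]

@[simp] theorem rootSign_ga : rootSign ga = -1 := by
  have : ga ∉ levelStab 1 := ga_notMem_levelStab 0
  simp [rootSign, this]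

/-- The product of the values of `χ` at the two sections `p`, `q` of an automorphism, which is
`pair p q` or `pair p q * a`. -/
noncomputable def sectionSign (χ : BinAut →* ℤˣ) : BinAut →* ℤˣ :=
  have key : ∀ g, ∃ e : ℤˣ, ∀ p q, g = pair p q ∨ g = pair p q * ga → e = χ p * χ q := fun g => by
    obtain ⟨p, q, h⟩ := exists_pair_or g
    refine ⟨χ p * χ q, fun p' q' h' => ?_⟩
    rcases h with rfl | rfl <;> rcases h' with h' | h'
    · obtain ⟨rfl, rfl⟩ := pair_inj.1 h'; rfl
    · exact absurd h' (pair_ne_pair_mul_ga _ _ _ _)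
    · exact absurd h'.symm (pair_ne_pair_mul_ga _ _ _ _)
    · obtain ⟨rfl, rfl⟩ := pair_inj.1 (mul_right_cancel h'); rfl
  { toFun := fun g => (key g).choose
    map_one' := by
      rw [(key 1).choose_spec 1 1 (Or.inl pair_one.symm)]
      simp
    map_mul' := fun g h => by
      obtain ⟨p, q, hg⟩ := exists_pair_or g
      obtain ⟨p', q', hh⟩ := exists_pair_or h
      rw [(key g).choose_spec p q hg, (key h).choose_spec p' q' hh]
      rcases hg with rfl | rfl <;> rcases hh with rfl | rfl
      · rw [(key _).choose_spec (p * p') (q * q') (Or.inl (pair_mul ..)), map_mul, map_mul,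
          mul_mul_mul_comm]
      · rw [(key _).choose_spec (p * p') (q * q') (Or.inr (by rw [← mul_assoc, pair_mul])),
          map_mul, map_mul, mul_mul_mul_comm]
      · rw [(key _).choose_spec (p * q') (q * p')
          (Or.inr (by rw [mul_assoc, ga_pair, ← mul_assoc, pair_mul])), map_mul, map_mul,
          mul_mul_mul_comm, mul_comm (χ q')]
      · rw [(key _).choose_spec (p * q') (q * p')
          (Or.inl (by rw [mul_assoc, ← mul_assoc ga, ga_pair_ga, pair_mul])), map_mul, map_mul,
          mul_mul_mul_comm, mul_comm (χ q')] }

@[simp] theorem sectionSign_pair (χ : BinAut →* ℤˣ) (p q : BinAut) :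
    sectionSign χ (pair p q) = χ p * χ q := by
  unfold sectionSign
  generalize_proofs key
  exact (key (pair p q)).choose_spec p q (Or.inl rfl)

@[simp] theorem sectionSign_ga (χ : BinAut →* ℤˣ) : sectionSign χ ga = 1 := by
  unfold sectionSign
  generalize_proofs key
  have := (key ga).choose_spec 1 1 (Or.inr (by rw [pair_one, one_mul]))
  simpa using this

/-- The product of the signs of the permutations of level one and level two. -/
noncomputable def signTwo : BinAut →* ℤˣ := rootSign * sectionSign rootSign

theorem signTwo_apply (g : BinAut) : signTwo g = rootSign g * sectionSign rootSign g := rfl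

@[simp] theorem sectionSign_gb : sectionSign rootSign gb = -1 := by
  rw [gb_eq, sectionSign_pair, rootSign_ga, gc_eq, rootSign_pair, mul_one]
@[simp] theorem sectionSign_gc : sectionSign rootSign gc = -1 := by
  rw [gc_eq, sectionSign_pair, rootSign_ga, gd_eq, rootSign_pair, mul_one]
@[simp] theorem rootSign_gb : rootSign gb = 1 := by rw [gb_eq, rootSign_pair]
@[simp] theorem rootSign_gc : rootSign gc = 1 := by rw [gc_eq, rootSign_pair]
@[simp] theorem rootSign_gd : rootSign gd = 1 := by rw [gd_eq, rootSign_pair]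
@[simp] theorem signTwo_ga : signTwo ga = -1 := by simp [signTwo_apply]
@[simp] theorem signTwo_gb : signTwo gb = -1 := by simp [signTwo_apply]
@[simp] theorem signTwo_gc : signTwo gc = -1 := by simp [signTwo_apply]

/-- The automorphisms that fix level one and have sections of trivial sign `signTwo`. -/
def signKernel : Subgroup BinAut where
  carrier := {g | ∃ p q, g = pair p q ∧ signTwo p = 1 ∧ signTwo q = 1}
  one_mem' := ⟨1, 1, pair_one.symm, by simp, by simp⟩
  mul_mem' := by
    rintro _ _ ⟨p, q, rfl, hp, hq⟩ ⟨p', q', rfl, hp', hq'⟩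
    exact ⟨p * p', q * q', pair_mul .., by simp [hp, hp'], by simp [hq, hq']⟩
  inv_mem' := by
    rintro _ ⟨p, q, rfl, hp, hq⟩
    exact ⟨p⁻¹, q⁻¹, pair_inv .., by simp [hp], by simp [hq]⟩

theorem signKernel_conj (g : BinAut) {k : BinAut} (hk : k ∈ signKernel) :
    g * k * g⁻¹ ∈ signKernel := by
  obtain ⟨p, q, rfl, hp, hq⟩ := hk
  obtain ⟨u, w, rfl | rfl⟩ := exists_pair_or g
  · exact ⟨u * p * u⁻¹, w * q * w⁻¹, by simp, by simp [hp], by simp [hq]⟩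
  · refine ⟨u * q * u⁻¹, w * p * w⁻¹, ?_, by simp [hq], by simp [hp]⟩
    rw [mul_inv_rev, generator_inv, mul_assoc, mul_assoc, ← mul_assoc (pair p q), ← mul_assoc ga,
      ← mul_assoc ga, ga_pair_ga]
    simp [mul_assoc]

theorem grigK_le_signKernel : grigK ≤ signKernel := grigK_le_of fun g _ =>
  signKernel_conj g ⟨_, _, gx_eq, by simp, by simp⟩

theorem sectionSign_grigK {k : BinAut} (hk : k ∈ grigK) : sectionSign rootSign k = 1 := by
  have : grigK ≤ (sectionSign rootSign).ker := grigK_le_of fun g _ => by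
    rw [MonoidHom.mem_ker]
    simp [gx]
  exact this hk

/-- An automorphism fixing level two has trivial `signTwo`, which is determined by the action on
that level. -/
theorem signTwo_eq_one {g : BinAut} (hg : g ∈ levelStab 2) : signTwo g = 1 := by
  obtain ⟨p, hp, q, hq, rfl⟩ := mem_levelStab_succ.1 hg
  obtain ⟨p0, -, p1, -, rfl⟩ := mem_levelStab_succ.1 hp
  obtain ⟨q0, -, q1, -, rfl⟩ := mem_levelStab_succ.1 hq
  simp [signTwo_apply]

/-- The representatives `b^i d^j (ada)^k a^l` of the cosets of `K`. -/
def cosetRep (i j k l : Bool) : BinAut :=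
  (bif i then gb else 1) * (bif j then gd else 1) * (bif k then ga * gd * ga else 1) *
    (bif l then ga else 1)

theorem cosetRep_mem (i j k l : Bool) : cosetRep i j k l ∈ grigorchukGroup := by
  have ha : ga ∈ grigorchukGroup := generator_mem _
  have hb : gb ∈ grigorchukGroup := generator_mem _
  have hd : gd ∈ grigorchukGroup := generator_mem _
  unfold cosetRep
  refine mul_mem (mul_mem (mul_mem ?_ ?_) ?_) ?_
  · cases i <;> simp [one_mem]
  · cases j <;> simp [one_mem]
  · cases k
    · exact one_mem _
    · exact mul_mem (mul_mem ha hd) ha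
  · cases l <;> simp [one_mem]

theorem gd_comm : gd * (ga * gd * ga) = ga * gd * ga * gd := by
  rw [ga_gd_ga, gd_eq]
  simp

theorem gb_mul_cosetRep (i j k l : Bool) : gb * cosetRep i j k l = cosetRep (!i) j k l := by
  cases i <;> simp [cosetRep, mul_assoc]

theorem gd_mul_cosetRep (i j k l : Bool) : gd * cosetRep i j k l = cosetRep i (!j) k l := by
  cases i <;> cases j <;> simp [cosetRep, mul_assoc]

/-- Conjugation by `a` exchanges `d` and `ada`, which commute. -/
theorem ga_mul_cosetRep_false (j k l : Bool) :
    ga * cosetRep false j k l = cosetRep false k j (!l) := by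
  have h1 : gd * (ga * (gd * ga)) = ga * (gd * (ga * gd)) := by
    simpa only [mul_assoc] using gd_comm
  cases j <;> cases k <;> cases l <;> simp [cosetRep, mul_assoc, ← h1]
  all_goals
    have h2 : gd * (ga * gd) = ga * (gd * (ga * (gd * ga))) := by
      rw [h1]; simp
    simp [h2]

theorem exists_cosetRep {g : BinAut} (hg : g ∈ grigorchukGroup) :
    ∃ i j k l, (cosetRep i j k l)⁻¹ * g ∈ grigK := by
  induction hg using grigorchuk_induction with
  | h1 => exact ⟨false, false, false, false, by simp [cosetRep, one_mem]⟩
  | hmul s g hg ih =>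
    have step : ∀ s g' r r' : BinAut, s * r = r' → r⁻¹ * g' ∈ grigK → r'⁻¹ * (s * g') ∈ grigK := by
      rintro s g' r _ rfl hm
      rw [mul_inv_rev, mul_assoc, inv_mul_cancel_left]
      exact hm
    obtain ⟨i, j, k, l, h⟩ := ih
    rcases s with _ | _ | _ | _
    · rcases i with _ | _
      · exact ⟨_, _, _, _, step _ _ _ _ (ga_mul_cosetRep_false j k l) h⟩
      · -- `a` commutes with `b` modulo `K`
        refine ⟨true, k, j, !l, ?_⟩
        rw [← Bool.not_false, ← gb_mul_cosetRep, ← ga_mul_cosetRep_false]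
        rw [← Bool.not_false, ← gb_mul_cosetRep] at h
        set r := cosetRep false j k l with hr
        have hrm : r ∈ grigorchukGroup := cosetRep_mem _ _ _ _
        have h1 := mul_mem (grigK_conj (inv_mem hrm) gx_mem) h
        convert h1 using 1
        simp [gx, mul_assoc]
    · exact ⟨_, _, _, _, step _ _ _ _ (gb_mul_cosetRep i j k l) h⟩
    · refine ⟨!i, !j, k, l, ?_⟩
      rw [show grigorchukGenerator .c = gb * gd from gb_mul_gd.symm, mul_assoc]
      exact step _ _ _ _ (gb_mul_cosetRep i (!j) k l)
        (step _ _ _ _ (gd_mul_cosetRep i j k l) h)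
    · exact ⟨_, _, _, _, step _ _ _ _ (gd_mul_cosetRep i j k l) h⟩

/-- A coset representative in the kernel of all the sign invariants is trivial. -/
theorem cosetRep_eq_one {i j k l : Bool} (h : cosetRep i j k l ∈ signKernel)
    (h' : sectionSign rootSign (cosetRep i j k l) = 1) : cosetRep i j k l = 1 := by
  have hp : cosetRep i j k false = pair ((bif i then ga else 1) * (bif k then gb else 1))
      ((bif i then gc else 1) * (bif j then gb else 1)) := by
    have e1 : (bif i then gb else 1) = pair (bif i then ga else 1) (bif i then gc else 1) := by
      cases i
      · simp
      · exact gb_eq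
    have e2 : (bif j then gd else 1) = pair 1 (bif j then gb else 1) := by
      cases j
      · simp
      · exact gd_eq
    have e3 : (bif k then ga * gd * ga else 1) = pair (bif k then gb else 1) 1 := by
      cases k
      · simp
      · exact ga_gd_ga
    rw [cosetRep, e1, e2, e3]
    simp
  obtain ⟨p, q, hpq, hp1, hq1⟩ := h
  rcases l with _ | _
  · rw [hp] at hpq
    obtain ⟨rfl, rfl⟩ := pair_inj.1 hpq
    rw [hp, sectionSign_pair] at h'
    revert hp1 hq1 h'
    cases i <;> cases j <;> cases k <;> simp [cosetRep]
  · have : cosetRep i j k true = cosetRep i j k false * ga := by simp [cosetRep]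
    rw [this, hp] at hpq
    exact absurd hpq.symm (pair_ne_pair_mul_ga _ _ _ _)

/-- The subgroup `K` is a congruence subgroup: it contains the third level stabilizer, whose
elements have trivial sign invariants and hence the trivial coset representative. -/
theorem levelStab_three_le {g : BinAut} (hg : g ∈ grigorchukGroup) (h3 : g ∈ levelStab 3) :
    g ∈ grigK := by
  obtain ⟨i, j, k, l, h⟩ := exists_cosetRep hg
  have hgk : g ∈ signKernel := by
    obtain ⟨p, hp, q, hq, rfl⟩ := mem_levelStab_succ.1 h3
    exact ⟨p, q, rfl, signTwo_eq_one hp, signTwo_eq_one hq⟩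
  have hgs : sectionSign rootSign g = 1 := by
    obtain ⟨p, hp, q, hq, rfl⟩ := mem_levelStab_succ.1 h3
    obtain ⟨p0, -, p1, -, rfl⟩ := mem_levelStab_succ.1 hp
    obtain ⟨q0, -, q1, -, rfl⟩ := mem_levelStab_succ.1 hq
    simp
  have hr : cosetRep i j k l = 1 := by
    apply cosetRep_eq_one
    · have := mul_mem hgk (inv_mem (grigK_le_signKernel h))
      simpa using this
    · have := sectionSign_grigK h
      simpa [hgs] using this
  simpa [hr] using h

/-! ### Lifting sections into the branching subgroup -/

/-- Every vertex `l` of level `n` is fixed by an element of `K` whose section at `l` is `s`. -/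
def LiftsToK (n : ℕ) (s : BinAut) : Prop :=
  ∀ l : List Bool, l.length = n → ∃ t ∈ grigK, Carries l l t s

theorem LiftsToK.mul {n : ℕ} {s s' : BinAut} (h : LiftsToK n s) (h' : LiftsToK n s') :
    LiftsToK n (s * s') := fun l hl => by
  obtain ⟨t, ht, hc⟩ := h l hl
  obtain ⟨t', ht', hc'⟩ := h' l hl
  exact ⟨t * t', mul_mem ht ht', hc.mul hc'⟩

theorem LiftsToK.conj {n : ℕ} {g s : BinAut} (hg : g ∈ grigorchukGroup) (h : LiftsToK n s) :
    LiftsToK n (g * s * g⁻¹) := fun l hl => by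
  obtain ⟨t, ht, hc⟩ := h l hl
  obtain ⟨u, hu, hcu⟩ := exists_carries (l := l) (l' := l) rfl hg
  exact ⟨u * t * u⁻¹, grigK_conj hu ht, (hcu.mul hc).mul hcu.inv⟩

theorem eq_append_of_length {l : List Bool} {n : ℕ} (hl : l.length = n + 1) :
    ∃ m i, m.length = n ∧ l = m ++ [i] :=
  ⟨l.dropLast, l.getLast (List.ne_nil_of_length_eq_add_one hl), by simp [hl],
    (List.dropLast_append_getLast _).symm⟩

theorem LiftsToK.pair_left {n : ℕ} {p q : BinAut} (h : LiftsToK n (pair p q)) :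
    LiftsToK (n + 1) p := fun l hl => by
  obtain ⟨m, i, hm, rfl⟩ := eq_append_of_length hl
  rcases i with _ | _
  · obtain ⟨t, ht, hc⟩ := h m hm
    refine ⟨t, ht, fun k => ?_⟩
    rw [atVertex_append, atVertex_append, hc]
    simp
  · have h' := h.conj (generator_mem .a)
    rw [generator_inv, ga_pair_ga] at h'
    obtain ⟨t, ht, hc⟩ := h' m hm
    refine ⟨t, ht, fun k => ?_⟩
    rw [atVertex_append, atVertex_append, hc]
    simp

theorem LiftsToK.pair_right {n : ℕ} {p q : BinAut} (h : LiftsToK n (pair p q)) :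
    LiftsToK (n + 1) q := by
  have h' := h.conj (generator_mem .a)
  rw [generator_inv, ga_pair_ga] at h'
  exact h'.pair_left

/-- The sections of `K` at the vertices of level three exhaust the Grigorchuk group. -/
theorem liftsToK_three {s : BinAut} (hs : s ∈ grigorchukGroup) : LiftsToK 3 s := by
  have h0 : LiftsToK 0 gx := fun l hl => by
    obtain rfl := List.length_eq_zero_iff.1 hl
    exact ⟨gx, gx_mem, fun _ => rfl⟩
  rw [gx_eq] at h0
  have hca : LiftsToK 1 (gc * ga) := h0.pair_left
  have hac : LiftsToK 1 (ga * gc) := h0.pair_right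
  have hbaba : LiftsToK 1 (gb * (ga * gc) * gb⁻¹ * (gc * ga)) :=
    (hac.conj (generator_mem .b)).mul hca
  have e1 : gb * (ga * gc) * gb⁻¹ * (gc * ga) = pair (ga * gc) (gc * ga) := by
    have : gb * (ga * gc) * gb⁻¹ * (gc * ga) = gb * (ga * gb * ga) := by simp [mul_assoc]
    rw [this]
    conv_lhs => rw [gb_eq]
    rw [ga_pair_ga, pair_mul]
  have e2 : ga * gc * (ga * gc) = pair (gd * ga) (ga * gd) := by
    have : ga * gc * (ga * gc) = ga * gc * ga * gc := by simp [mul_assoc]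
    rw [this]
    conv_lhs => rw [gc_eq]
    rw [ga_pair_ga, pair_mul]
  rw [e1] at hbaba
  have h2ac : LiftsToK 2 (ga * gc) := hbaba.pair_left
  have h2da : LiftsToK 2 (gd * ga) := by
    have := hac.mul hac
    rw [e2] at this
    exact this.pair_left
  have h2b : LiftsToK 2 (pair ga gc) := by
    have := h2da.mul h2ac
    have e : gd * ga * (ga * gc) = pair ga gc := by rw [← gb_eq]; simp [mul_assoc]
    rwa [e] at this
  have h3a : LiftsToK 3 ga := h2b.pair_left
  have h3c : LiftsToK 3 gc := h2b.pair_right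
  have h3d : LiftsToK 3 gd := by
    have := h2ac.mul h2ac
    rw [e2] at this
    have := this.pair_left.mul h3a
    rwa [mul_assoc, ga_mul_ga, mul_one] at this
  have h3b : LiftsToK 3 gb := by
    have := h3c.mul h3d
    rwa [gc_mul_gd] at this
  induction hs using grigorchuk_induction with
  | h1 => exact fun l _ => ⟨1, one_mem _, fun k => by simp⟩
  | hmul s g hg ih =>
    refine LiftsToK.mul ?_ ih
    rcases s with _ | _ | _ | _
    exacts [h3a, h3b, h3c, h3d]

/-- The set of commutators of elements of `κ`. -/
def commutatorsIn {G : Type*} [Group G] (κ : Subgroup G) : Set G :=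
  {z | ∃ k ∈ κ, ∃ k' ∈ κ, ⁅k, k'⁆ = z}

/-- Below a vertex of level three, a commutator with an element of the Grigorchuk group is a
commutator of two elements of `κ`. -/
theorem atVertex_commutator_mem {κ : Subgroup BinAut} (hK : grigK ≤ κ)
    (hκ : ∀ i, ∀ k ∈ κ, atLetter i k ∈ κ) {l : List Bool} (hl : l.length = 3) {k s : BinAut}
    (hk : k ∈ κ) (hs : s ∈ grigorchukGroup) : atVertex l ⁅k, s⁆ ∈ commutatorsIn κ := by
  obtain ⟨t, ht, hc⟩ := liftsToK_three hs l hl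
  refine ⟨atVertex l k, atVertex_mem hκ l hk, t, hK ht, ?_⟩
  have := hc k⁻¹
  rw [commutatorElement_def, commutatorElement_def, mul_assoc, mul_assoc, ← map_inv,
    ← mul_assoc t, this, ← map_mul]
  simp only [mul_assoc]

/-! ### Commutators with generators in residually nilpotent groups -/

section Nilpotent

variable {G : Type*} [Group G]

/-- The products `⁅m₁, s₁⁆ ⋯ ⁅mᵣ, sᵣ⁆` with `mᵢ ∈ M`, for a list of elements `sᵢ`. -/
def commProd (M : Subgroup G) : List G → Set G
  | [] => {1}
  | s :: l => {z | ∃ m ∈ M, ∃ w ∈ commProd M l, ⁅m, s⁆ * w = z}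

theorem one_mem_commProd (M : Subgroup G) (l : List G) : (1 : G) ∈ commProd M l := by
  induction l with
  | nil => rfl
  | cons s l ih => exact ⟨1, one_mem _, 1, ih, by simp⟩

theorem commProd_mono {M N : Subgroup G} (h : M ≤ N) (l : List G) :
    commProd M l ⊆ commProd N l := by
  induction l with
  | nil => exact le_rfl
  | cons s l ih =>
    rintro _ ⟨m, hm, w, hw, rfl⟩
    exact ⟨m, h hm, w, ih hw, rfl⟩

theorem image_commProd {H : Type*} [Group H] (f : G →* H) (M : Subgroup G) (l : List G) :
    f '' commProd M l = commProd (M.map f) (l.map f) := by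
  induction l with
  | nil => simp [commProd]
  | cons s l ih =>
    ext z
    constructor
    · rintro ⟨_, ⟨m, hm, w, hw, rfl⟩, rfl⟩
      exact ⟨f m, ⟨m, hm, rfl⟩, f w, ih ▸ ⟨w, hw, rfl⟩, by simp [map_commutatorElement]⟩
    · rintro ⟨_, ⟨m, hm, rfl⟩, w', hw', rfl⟩
      rw [← ih] at hw'
      obtain ⟨w, hw, rfl⟩ := hw'
      exact ⟨⁅m, s⁆ * w, ⟨m, hm, w, hw, rfl⟩, by simp [map_commutatorElement]⟩

theorem commutator_mul_of_central {n m s : G} (h : ∀ g, ⁅m, s⁆ * g = g * ⁅m, s⁆) :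
    ⁅n * m, s⁆ = ⁅n, s⁆ * ⁅m, s⁆ := by
  have : ⁅n * m, s⁆ = n * ⁅m, s⁆ * (s * n⁻¹ * s⁻¹) := by
    simp only [commutatorElement_def]; group
  rw [this, ← h n, mul_assoc, h]
  simp only [commutatorElement_def]
  group

/-- If the commutators `⁅m, s⁆` with `m ∈ M` are central, they can be collected factor by factor. -/
theorem mul_mem_commProd {M N : Subgroup G} (hMN : M ≤ N)
    (hM : ∀ m ∈ M, ∀ s g : G, ⁅m, s⁆ * g = g * ⁅m, s⁆) (l : List G) {z w : G}
    (hz : z ∈ commProd N l) (hw : w ∈ commProd M l) : z * w ∈ commProd N l := by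
  induction l generalizing z w with
  | nil => rw [Set.mem_singleton_iff.1 hz, Set.mem_singleton_iff.1 hw]; exact (one_mul (1 : G))
  | cons s l ih =>
    obtain ⟨n, hn, z, hz, rfl⟩ := hz
    obtain ⟨m, hm, w, hw, rfl⟩ := hw
    refine ⟨n * m, mul_mem hn (hMN hm), z * w, ih hz hw, ?_⟩
    rw [commutator_mul_of_central (hM m hm s), mul_assoc, mul_assoc, ← mul_assoc z, ← hM m hm s z,
      mul_assoc]

/-- If the commutators with elements of `M` are central, then `[M, G]` consists of the products of
commutators with generators of `G`, one for each generator. -/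
theorem mem_commProd_of_central {M : Subgroup G}
    (hM : ∀ m ∈ M, ∀ s g : G, ⁅m, s⁆ * g = g * ⁅m, s⁆) {l : List G}
    (hl : Subgroup.closure {s | s ∈ l} = ⊤) {z : G} (hz : z ∈ ⁅M, (⊤ : Subgroup G)⁆) :
    z ∈ commProd M l := by
  have hmul : ∀ {z w}, z ∈ commProd M l → w ∈ commProd M l → z * w ∈ commProd M l :=
    fun hz hw => mul_mem_commProd le_rfl hM l hz hw
  have hsingle : ∀ l : List G, ∀ m ∈ M, ∀ s ∈ l, ⁅m, s⁆ ∈ commProd M l := fun l m hm s hs => by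
    induction l with
    | nil => simp at hs
    | cons t l ih =>
      rcases List.mem_cons.1 hs with rfl | hs
      · exact ⟨m, hm, 1, one_mem_commProd _ _, mul_one _⟩
      · exact ⟨1, one_mem _, _, ih hs, by simp⟩
  have hgen : ∀ g : G, ∀ m ∈ M, ⁅m, g⁆ ∈ commProd M l := fun g => by
    have hg : g ∈ Subgroup.closure {s | s ∈ l} := hl ▸ Subgroup.mem_top g
    induction hg using Subgroup.closure_induction with
    | mem s hs => exact fun m hm => hsingle l m hm s hs
    | one => exact fun m _ => by simpa using one_mem_commProd M l
    | mul g h _ _ ihg ihh =>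
      intro m hm
      have : ⁅m, g * h⁆ = ⁅m, g⁆ * ⁅m, h⁆ := by
        have e : ⁅m, g * h⁆ = ⁅m, g⁆ * (g * ⁅m, h⁆ * g⁻¹) := by
          simp only [commutatorElement_def]; group
        rw [e, ← hM m hm h g, mul_inv_cancel_right]
      rw [this]
      exact hmul (ihg m hm) (ihh m hm)
    | inv g _ ih =>
      intro m hm
      have : ⁅m, g⁻¹⁆ = ⁅m⁻¹, g⁆ := by
        have e : ⁅m, g⁻¹⁆ = g⁻¹ * ⁅m, g⁆⁻¹ * g := by
          simp only [commutatorElement_def]; group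
        have e2 : ⁅m⁻¹, g⁆ * ⁅m, g⁆ = 1 := by
          rw [← commutator_mul_of_central (hM m hm g), inv_mul_cancel]; simp
        have e3 : ⁅m, g⁆⁻¹ = ⁅m⁻¹, g⁆ := inv_eq_of_mul_eq_one_left e2
        rw [e, e3, mul_assoc, hM _ (inv_mem hm), inv_mul_cancel_left]
      rw [this]
      exact ih _ (inv_mem hm)
  rw [Subgroup.commutator_def] at hz
  induction hz using Subgroup.closure_induction with
  | mem z hz =>
    obtain ⟨m, hm, g, -, rfl⟩ := hz
    exact hgen g m hm
  | one => exact one_mem_commProd _ _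
  | mul z w _ _ ihz ihw => exact hmul ihz ihw
  | inv z hz ih =>
    have : ∀ l : List G, ∀ z ∈ commProd M l, z⁻¹ ∈ commProd M l := fun l => by
      induction l with
      | nil => rintro z rfl; exact inv_one
      | cons s l ih =>
        rintro _ ⟨m, hm, w, hw, rfl⟩
        refine ⟨m⁻¹, inv_mem hm, w⁻¹, ih w hw, ?_⟩
        have e2 : ⁅m⁻¹, s⁆ * ⁅m, s⁆ = 1 := by
          rw [← commutator_mul_of_central (hM m hm s), inv_mul_cancel]; simp
        rw [mul_inv_rev, inv_eq_of_mul_eq_one_left e2, hM _ (inv_mem hm)]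
    exact this l z ih

/-- The descending series `N ≥ [N, G] ≥ [N, G, G] ≥ …`. -/
def commSeries (N : Subgroup G) : ℕ → Subgroup G
  | 0 => N
  | j + 1 => ⁅commSeries N j, ⊤⁆

theorem commSeries_normal (N : Subgroup G) [hN : N.Normal] (j : ℕ) : (commSeries N j).Normal := by
  induction j with
  | zero => exact hN
  | succ j ih => exact Subgroup.commutator_normal _ _

theorem commSeries_le (N : Subgroup G) [N.Normal] (j : ℕ) : commSeries N j ≤ N := by
  induction j with
  | zero => exact le_rfl
  | succ j ih =>
    have := commSeries_normal N j
    exact Subgroup.commutator_le_left _ _ |>.trans ih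

theorem commSeries_le_lowerCentralSeries (N : Subgroup G) (j : ℕ) :
    commSeries N j ≤ (⊤ : Subgroup G).lowerCentralSeries j := by
  induction j with
  | zero => exact le_top
  | succ j ih => exact Subgroup.commutator_mono ih le_rfl

/-- Modulo each term of the series `[N, G, …, G]`, the elements of `[N, G]` are products of
commutators with the generators of `G`, one for each generator. -/
theorem exists_commProd (N : Subgroup G) [N.Normal] {l : List G}
    (hl : Subgroup.closure {s | s ∈ l} = ⊤) {g : G} (hg : g ∈ ⁅N, (⊤ : Subgroup G)⁆) (j : ℕ) :
    ∃ z ∈ commProd N l, z⁻¹ * g ∈ commSeries N (j + 1) := by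
  induction j with
  | zero => exact ⟨1, one_mem_commProd _ _, by simpa [commSeries] using hg⟩
  | succ j ih =>
    obtain ⟨z, hz, hzg⟩ := ih
    have := commSeries_normal N (j + 2)
    set π := QuotientGroup.mk' (commSeries N (j + 2)) with hπ
    have hsurj : Function.Surjective π := QuotientGroup.mk'_surjective _
    have hker : ∀ x y, π x = π y ↔ x⁻¹ * y ∈ commSeries N (j + 2) := fun x y =>
      QuotientGroup.eq
    have hcentral : ∀ m ∈ (commSeries N j).map π, ∀ s g : G ⧸ commSeries N (j + 2),
        ⁅m, s⁆ * g = g * ⁅m, s⁆ := by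
      rintro _ ⟨m, hm, rfl⟩ s g
      obtain ⟨s, rfl⟩ := hsurj s
      obtain ⟨g, rfl⟩ := hsurj g
      rw [← map_commutatorElement, ← map_mul, ← map_mul, eq_comm, hker]
      have h1 : ⁅m, s⁆⁻¹ ∈ commSeries N (j + 1) :=
        inv_mem (Subgroup.commutator_mem_commutator hm (Subgroup.mem_top s))
      have h2 : ⁅⁅m, s⁆⁻¹, g⁻¹⁆ ∈ commSeries N (j + 2) :=
        Subgroup.commutator_mem_commutator h1 (Subgroup.mem_top g⁻¹)
      convert h2 using 1
      simp only [commutatorElement_def]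
      group
    have hl' : Subgroup.closure {s | s ∈ l.map π} = ⊤ := by
      have : {s | s ∈ l.map π} = π '' {s | s ∈ l} := by ext; simp
      rw [this, ← MonoidHom.map_closure, hl, Subgroup.map_top_of_surjective _ hsurj]
    have hw : π (z⁻¹ * g) ∈ ⁅(commSeries N j).map π, (⊤ : Subgroup _)⁆ := by
      have := Subgroup.mem_map_of_mem π hzg
      rwa [show commSeries N (j + 1) = ⁅commSeries N j, ⊤⁆ from rfl,
        Subgroup.map_commutator, Subgroup.map_top_of_surjective _ hsurj] at this
    have hw' := mem_commProd_of_central hcentral hl' hw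
    have hz' : π z ∈ commProd (N.map π) (l.map π) := by
      rw [← image_commProd]
      exact ⟨z, hz, rfl⟩
    have := mul_mem_commProd (Subgroup.map_mono (commSeries_le N j)) hcentral _ hz' hw'
    rw [← map_mul, mul_inv_cancel_left, ← image_commProd] at this
    obtain ⟨y, hy, hyg⟩ := this
    exact ⟨y, hy, (hker _ _).1 hyg⟩

end Nilpotent

/-! ### The closures of the Grigorchuk group and of its branching subgroup -/

/-- The generators as a list. -/
def generatorList : List BinAut := [ga, gb, gc, gd]

theorem mem_generatorList {s : BinAut} (hs : s ∈ generatorList) : s ∈ grigorchukGroup := by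
  simp only [generatorList, List.mem_cons, List.not_mem_nil, or_false] at hs
  rcases hs with rfl | rfl | rfl | rfl <;> exact generator_mem _

/-- The quotient of the Grigorchuk group by a level stabilizer is a finite `2`-group, hence
nilpotent. -/
theorem exists_lowerCentralSeries_le (n : ℕ) :
    ∃ j, (⊤ : Subgroup grigorchukGroup).lowerCentralSeries j ≤
      (levelStab n).subgroupOf grigorchukGroup := by
  set R := (levelStab n).subgroupOf grigorchukGroup
  have : (levelStab n).FiniteIndex := Subgroup.finiteIndex_of_finite_quotient
  have hfin : Finite (grigorchukGroup ⧸ R) := inferInstance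
  have hp : IsPGroup 2 (grigorchukGroup ⧸ R) := fun g => by
    obtain ⟨g, rfl⟩ := QuotientGroup.mk_surjective g
    refine ⟨n, ?_⟩
    rw [← QuotientGroup.mk_pow, QuotientGroup.eq_one_iff]
    exact pow_mem_levelStab n g.1
  have : Fact (Nat.Prime 2) := ⟨Nat.prime_two⟩
  have hnil := hp.isNilpotent
  obtain ⟨j, hj⟩ := Subgroup.nilpotent_iff_lowerCentralSeries.1 hnil
  refine ⟨j, ?_⟩
  have h1 := ((⊤ : Subgroup grigorchukGroup).map_lowerCentralSeries (QuotientGroup.mk' R)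
    j).le.trans (Subgroup.lowerCentralSeries_mono j le_top)
  beta_reduce at h1
  rw [hj, le_bot_iff, Subgroup.map_eq_bot_iff, QuotientGroup.ker_mk'] at h1
  exact h1

/-- The elements of `K × 1 ≤ [K, G]` are, up to arbitrarily deep level stabilizers, products of four
commutators of elements of `K` with the generators. -/
theorem exists_commProd_atLetter (i : Bool) {k : BinAut} (hk : k ∈ grigK) (n : ℕ) :
    ∃ z ∈ commProd grigK generatorList, z⁻¹ * atLetter i k ∈ levelStab n := by
  obtain ⟨j, hj⟩ := exists_lowerCentralSeries_le n
  set N := grigK.subgroupOf grigorchukGroup with hNdef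
  have hN : N.Normal := ⟨fun k hk g => grigK_conj g.2 hk⟩
  have hNmap : N.map grigorchukGroup.subtype = grigK := by
    rw [hNdef, Subgroup.subgroupOf_map_subtype, inf_eq_left]
    exact grigK_le
  have hcomm := atLetter_mem_commutator i hk
  have hmap : (⁅N, (⊤ : Subgroup grigorchukGroup)⁆).map grigorchukGroup.subtype =
      ⁅grigK, grigorchukGroup⁆ := by
    rw [Subgroup.map_commutator, hNmap, ← MonoidHom.range_eq_map, Subgroup.range_subtype]
  rw [← hmap] at hcomm
  obtain ⟨g, hg, hgk⟩ := hcomm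
  let l : List grigorchukGroup := [⟨ga, generator_mem _⟩, ⟨gb, generator_mem _⟩,
    ⟨gc, generator_mem _⟩, ⟨gd, generator_mem _⟩]
  have hlmap : l.map grigorchukGroup.subtype = generatorList := rfl
  have hl : Subgroup.closure {s | s ∈ l} = ⊤ := by
    rw [eq_top_iff, ← Subgroup.map_le_map_iff_of_injective grigorchukGroup.subtype_injective,
      ← MonoidHom.range_eq_map, Subgroup.range_subtype, MonoidHom.map_closure]
    refine grigorchuk_le fun s => Subgroup.subset_closure
      ⟨⟨grigorchukGenerator s, generator_mem s⟩, ?_, rfl⟩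
    rcases s with _ | _ | _ | _ <;> simp [l]
  obtain ⟨z, hz, hzg⟩ := exists_commProd N hl hg j
  refine ⟨z.1, ?_, ?_⟩
  · have := image_commProd grigorchukGroup.subtype N l
    rw [hNmap, hlmap] at this
    rw [← this]
    exact ⟨z, hz, rfl⟩
  · have h1 := (commSeries_le_lowerCentralSeries N (j + 1)).trans
      ((Subgroup.lowerCentralSeries_antitone _ (Nat.le_succ j)).trans hj) hzg
    rw [← hgk]
    exact h1

/-- The closure of the Grigorchuk group in `Aut(T_2)`. -/
noncomputable def grigBar : Subgroup BinAut := grigorchukGroup.topologicalClosure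

/-- The closure of the branching subgroup in `Aut(T_2)`. -/
noncomputable def grigKBar : Subgroup BinAut := grigK.topologicalClosure

theorem mem_grigBar {g : BinAut} :
    g ∈ grigBar ↔ ∀ n, ∃ s ∈ grigorchukGroup, s⁻¹ * g ∈ levelStab n :=
  mem_closure_iff_levelStab

theorem mem_grigKBar {g : BinAut} : g ∈ grigKBar ↔ ∀ n, ∃ s ∈ grigK, s⁻¹ * g ∈ levelStab n :=
  mem_closure_iff_levelStab

/-- A self-similar group `Γ` containing the Grigorchuk group, with a congruence subgroup `κ ≥ K`
over which it is branch. This abstracts what the pair of the Grigorchuk group and `K` has in common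
with the pair of their closures. -/
structure IsBranchPair (Γ κ : Subgroup BinAut) : Prop where
  selfSimilar : IsSelfSimilar Γ
  grigorchuk_le : grigorchukGroup ≤ Γ
  grigK_le : grigK ≤ κ
  le : κ ≤ Γ
  atLetter_mem : ∀ i, ∀ k ∈ κ, atLetter i k ∈ κ
  levelStab_three : ∀ g ∈ Γ, g ∈ levelStab 3 → g ∈ κ
  atLetter_mem_commutator : ∀ i, ∀ k ∈ κ, atLetter i k ∈ ⁅κ, grigorchukGroup⁆

theorem isBranchPair_grigorchuk : IsBranchPair grigorchukGroup grigK where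
  selfSimilar := isSelfSimilar_grigorchuk
  grigorchuk_le := le_rfl
  grigK_le := le_rfl
  le := grigK_le
  atLetter_mem := fun i _ hk => atLetter_mem_grigK i hk
  levelStab_three := fun _ hg h => levelStab_three_le hg h
  atLetter_mem_commutator := fun i _ hk => atLetter_mem_commutator i hk

theorem atLetter_mem_levelStab (i : Bool) {n : ℕ} {g : BinAut} (hg : g ∈ levelStab n) :
    atLetter i g ∈ levelStab n :=
  levelStab_succ_le n (by cases i <;> simp [hg, one_mem])

theorem isCompact_commProd {κ : Subgroup BinAut} (hκ : IsClosed (κ : Set BinAut))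
    (l : List BinAut) : IsCompact (commProd κ l) := by
  induction l with
  | nil => exact isCompact_singleton
  | cons s l ih =>
    have : commProd κ (s :: l) =
        (fun p : BinAut × BinAut => ⁅p.1, s⁆ * p.2) '' ((κ : Set BinAut) ×ˢ commProd κ l) := by
      ext z
      simp only [commProd, Set.mem_ofPred_eq, Set.mem_image, Set.mem_prod, Prod.exists]
      constructor
      · rintro ⟨m, hm, w, hw, rfl⟩; exact ⟨m, w, ⟨hm, hw⟩, rfl⟩
      · rintro ⟨m, w, ⟨hm, hw⟩, rfl⟩; exact ⟨m, hm, w, hw, rfl⟩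
    rw [this]
    refine (hκ.isCompact.prod ih).image ?_
    simp only [commutatorElement_def]
    fun_prop

theorem isClosed_grigKBar : IsClosed (grigKBar : Set BinAut) :=
  Subgroup.isClosed_topologicalClosure _

theorem grigK_le_grigKBar : grigK ≤ grigKBar := Subgroup.le_topologicalClosure _

theorem grigorchuk_le_grigBar : grigorchukGroup ≤ grigBar := Subgroup.le_topologicalClosure _

/-- In the closure the approximation in `exists_commProd_atLetter` becomes exact, as the set of
products is compact. -/
theorem atLetter_mem_commProd (i : Bool) {k : BinAut} (hk : k ∈ grigKBar) :
    atLetter i k ∈ commProd grigKBar generatorList := by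
  rw [← (isCompact_commProd isClosed_grigKBar _).isClosed.closure_eq, mem_closure_iff_levelStab]
  intro n
  obtain ⟨k0, hk0, h⟩ := mem_grigKBar.1 hk n
  obtain ⟨z, hz, hzk⟩ := exists_commProd_atLetter i hk0 n
  refine ⟨z, commProd_mono grigK_le_grigKBar _ hz, ?_⟩
  have := mul_mem hzk (atLetter_mem_levelStab i h)
  simpa [mul_assoc] using this

theorem commProd_subset_commutator {κ : Subgroup BinAut} (l : List BinAut)
    (hl : ∀ s ∈ l, s ∈ grigorchukGroup) :
    commProd κ l ⊆ (⁅κ, grigorchukGroup⁆ : Subgroup BinAut) := by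
  induction l with
  | nil => rintro _ rfl; exact one_mem _
  | cons s l ih =>
    rintro _ ⟨m, hm, w, hw, rfl⟩
    exact mul_mem (Subgroup.commutator_mem_commutator hm (hl s List.mem_cons_self))
      (ih (fun t ht => hl t (List.mem_cons_of_mem _ ht)) hw)

theorem isBranchPair_grigBar : IsBranchPair grigBar grigKBar where
  selfSimilar := fun p q h => by
    rw [mem_grigBar] at h
    have key : ∀ n, ∃ u ∈ grigorchukGroup, ∃ w ∈ grigorchukGroup,
        u⁻¹ * p ∈ levelStab n ∧ w⁻¹ * q ∈ levelStab n := fun n => by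
      obtain ⟨s, hs, hsn⟩ := h (n + 1)
      obtain ⟨p', hp, q', hq, he⟩ := mem_levelStab_succ.1 hsn
      have hse : s = pair (p * p'⁻¹) (q * q'⁻¹) := by
        rw [← pair_mul, ← pair_inv, ← he]; group
      rw [hse] at hs
      obtain ⟨h1, h2⟩ := isSelfSimilar_grigorchuk _ _ hs
      exact ⟨_, h1, _, h2, by simpa using hp, by simpa using hq⟩
    refine ⟨mem_grigBar.2 fun n => ?_, mem_grigBar.2 fun n => ?_⟩
    · obtain ⟨u, hu, w, hw, h1, h2⟩ := key n
      exact ⟨u, hu, h1⟩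
    · obtain ⟨u, hu, w, hw, h1, h2⟩ := key n
      exact ⟨w, hw, h2⟩
  grigorchuk_le := grigorchuk_le_grigBar
  grigK_le := grigK_le_grigKBar
  le := Subgroup.topologicalClosure_mono grigK_le
  atLetter_mem := fun i k hk => mem_grigKBar.2 fun n => by
    obtain ⟨k0, hk0, h⟩ := mem_grigKBar.1 hk n
    exact ⟨atLetter i k0, atLetter_mem_grigK i hk0, by
      simpa using atLetter_mem_levelStab i h⟩
  levelStab_three := fun g hg h3 => mem_grigKBar.2 fun n => by
    obtain ⟨s, hs, h⟩ := mem_grigBar.1 hg (max n 3)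
    refine ⟨s, levelStab_three_le hs ?_, levelStab_antitone (le_max_left n 3) h⟩
    have := mul_mem h3 (inv_mem (levelStab_antitone (le_max_right n 3) h))
    simpa using this
  atLetter_mem_commutator := fun i k hk =>
    commProd_subset_commutator _ (fun _ hs => mem_generatorList hs) (atLetter_mem_commProd i hk)

/-! ### Derived subgroups contain congruence subgroups -/

/-- The sections of an element of the seventh level stabilizer at the vertices `m i` of level four
lie in `κ`. Below `i` they are elements of `[κ, G]`, and these become elements of `[κ, κ]` below the
vertex `m` of level three. -/
theorem IsBranchPair.levelStab_le_commutator {Γ κ : Subgroup BinAut} (h : IsBranchPair Γ κ) :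
    Γ ⊓ levelStab 7 ≤ ⁅κ, κ⁆ := by
  rintro g ⟨hg, h7⟩
  obtain ⟨f, hf, rfl⟩ := h.selfSimilar.exists_levelProd (n := 4) (m := 3) hg h7
  refine levelProd_mem fun l hl => ?_
  obtain ⟨m, i, hm, rfl⟩ := eq_append_of_length hl
  have hle : ⁅κ, grigorchukGroup⁆ ≤ (⁅κ, κ⁆).comap (atVertex m) := by
    rw [Subgroup.commutator_le]
    intro k hk s hs
    obtain ⟨k, hk, k', hk', he⟩ := atVertex_commutator_mem h.grigK_le h.atLetter_mem hm hk hs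
    rw [Subgroup.mem_comap, ← he]
    exact Subgroup.commutator_mem_commutator hk hk'
  rw [atVertex_append]
  exact hle (h.atLetter_mem_commutator i _ (h.levelStab_three _ (hf _).1 (hf _).2))

theorem atVertex_commProd {κ : Subgroup BinAut} (hK : grigK ≤ κ)
    (hκ : ∀ i, ∀ k ∈ κ, atLetter i k ∈ κ) {m : List Bool} (hm : m.length = 3) (l : List BinAut)
    (hl : ∀ s ∈ l, s ∈ grigorchukGroup) {z : BinAut} (hz : z ∈ commProd κ l) :
    atVertex m z ∈ commutatorsIn κ ^ l.length := by
  induction l generalizing z with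
  | nil => rw [Set.mem_singleton_iff.1 hz]; simp
  | cons s l ih =>
    obtain ⟨k, hk, w, hw, rfl⟩ := hz
    rw [List.length_cons, pow_succ', map_mul]
    exact Set.mul_mem_mul (atVertex_commutator_mem hK hκ hm hk (hl s List.mem_cons_self))
      (ih (fun t ht => hl t (List.mem_cons_of_mem _ ht)) hw)

/-- The elements of the seventh congruence subgroup of the closure are products of `64`
commutators of elements of the closure of `K`: four, one for each generator, for each of the `2 ^ 4`
vertices of level four. -/
theorem levelStab_subset_pow :
    ((grigBar ⊓ levelStab 7 : Subgroup BinAut) : Set BinAut) ⊆ commutatorsIn grigKBar ^ 64 := by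
  have h := isBranchPair_grigBar
  rintro g ⟨hg, h7⟩
  obtain ⟨f, hf, rfl⟩ := h.selfSimilar.exists_levelProd (n := 4) (m := 3) hg h7
  refine levelProd_mem_pow (k := 4) (n := 4) fun l hl => ?_
  obtain ⟨m, i, hm, rfl⟩ := eq_append_of_length hl
  rw [atVertex_append]
  exact atVertex_commProd h.grigK_le h.atLetter_mem hm generatorList
    (fun _ hs => mem_generatorList hs)
    (atLetter_mem_commProd i (h.levelStab_three _ (hf _).1 (hf _).2))

/-! ### Normal subgroups contain congruence subgroups -/

/-- If `g` moves the vertex `l`, then commuting with elements supported below `l` and below `g l`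
isolates commutators supported below `l`. -/
theorem exists_atVertex_commutator {n : ℕ} {g : BinAut} (hg : g ∉ levelStab n) :
    ∃ l, ∀ k k', ⁅⁅g, atVertex l k⁆, atVertex l k'⁆ = atVertex l ⁅k⁻¹, k'⁆ := by
  induction n generalizing g with
  | zero => simp at hg
  | succ n ih =>
    obtain ⟨p, q, rfl | rfl⟩ := exists_pair_or g
    · rw [pair_mem_levelStab, not_and_or] at hg
      rcases hg with hg | hg
      · obtain ⟨l, hl⟩ := ih hg
        exact ⟨false :: l, fun k k' => by simp [hl]⟩
      · obtain ⟨l, hl⟩ := ih hg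
        exact ⟨true :: l, fun k k' => by simp [hl]⟩
    · refine ⟨[false], fun k k' => ?_⟩
      have : ⁅pair p q * ga, pair k 1⁆ = pair k⁻¹ (q * k * q⁻¹) := by
        rw [commutatorElement_def, mul_inv_rev, generator_inv, mul_assoc (pair p q),
          mul_assoc (pair p q), ← mul_assoc (ga * pair k 1), ga_pair_ga]
        simp [mul_assoc]
      simp [this]

/-- A nontrivial subgroup `N` normalized by `Γ` contains a level stabilizer: it contains `[κ, κ]`
below some vertex, hence below all vertices of the same level. -/
theorem IsBranchPair.exists_levelStab_le {Γ κ : Subgroup BinAut} (h : IsBranchPair Γ κ)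
    {N : Subgroup BinAut} (hN : ∀ g ∈ Γ, ∀ x ∈ N, g * x * g⁻¹ ∈ N) {g : BinAut} (hgN : g ∈ N)
    (hg : g ≠ 1) : ∃ m, Γ ⊓ levelStab m ≤ N := by
  obtain ⟨n, hn⟩ : ∃ n, g ∉ levelStab n := by
    by_contra! H
    exact hg (eq_one_of_forall_mem_levelStab H)
  obtain ⟨l, hl⟩ := exists_atVertex_commutator hn
  have hcomm : ∀ x ∈ N, ∀ y ∈ Γ, ⁅x, y⁆ ∈ N := fun x hx y hy => by
    have := mul_mem hx (hN y hy _ (inv_mem hx))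
    simpa [commutatorElement_def, mul_assoc] using this
  have hΓ : ∀ k ∈ κ, atVertex l k ∈ Γ := fun k hk => h.le (atVertex_mem h.atLetter_mem l hk)
  have hle : ⁅κ, κ⁆ ≤ N.comap (atVertex l) := by
    rw [Subgroup.commutator_le]
    intro k hk k' hk'
    have := hl k⁻¹ k'
    rw [inv_inv] at this
    rw [Subgroup.mem_comap, ← this]
    exact hcomm _ (hcomm _ hgN _ (hΓ _ (inv_mem hk))) _ (hΓ _ hk')
  refine ⟨l.length + 7, fun x hx => ?_⟩
  obtain ⟨f, hf, rfl⟩ := h.selfSimilar.exists_levelProd hx.1 hx.2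
  refine levelProd_mem fun l' hl' => ?_
  obtain ⟨t, ht, hc⟩ := exists_carries hl'.symm (one_mem _)
  have h1 : atVertex l (f l') ∈ N := hle (h.levelStab_le_commutator (hf l'))
  have h2 := hc (f l')
  rw [one_mul, inv_one, mul_one] at h2
  rw [← h2]
  exact hN t (h.grigorchuk_le ht) _ h1

/-! ### The congruence subgroup property and the profinite completion -/

theorem gx_ne_one : gx ≠ 1 := by
  rw [gx_eq, Ne, pair_eq_one, not_and_or]
  left
  intro h
  rw [gc_eq, eq_comm, ← pair_one] at h
  exact pair_ne_pair_mul_ga _ _ _ _ h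

theorem infinite_grigorchuk : Infinite grigorchukGroup := by
  by_contra hfin
  rw [not_infinite_iff_finite] at hfin
  have h : ∀ g : grigorchukGroup, ∃ n, g.1 ∈ levelStab n → g = 1 := fun g => by
    by_cases hg : g = 1
    · exact ⟨0, fun _ => hg⟩
    · by_contra! H
      exact hg (Subtype.ext (eq_one_of_forall_mem_levelStab fun n => (H n).1))
  choose n hn using h
  obtain ⟨M, hM⟩ := Set.Finite.bddAbove (Set.finite_range n)
  have hx := atVertex_mem (fun i k hk => atLetter_mem_grigK i hk) (List.replicate M false) gx_mem
  have h1 : atVertex (List.replicate M false) gx ∈ levelStab M := by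
    have := atVertex_mem_levelStab (n := 0) (l := List.replicate M false) (g := gx) (by simp)
    simpa using this
  have h2 := hn ⟨_, grigK_le hx⟩ (levelStab_antitone (hM ⟨_, rfl⟩) h1)
  have h3 : atVertex (List.replicate M false) gx = atVertex (List.replicate M false) 1 := by
    rw [map_one]; exact congrArg Subtype.val h2
  exact gx_ne_one (atVertex_injective _ h3)

/-- The congruence subgroup property of the Grigorchuk group. -/
theorem exists_levelStab_subgroupOf_le (N : Subgroup grigorchukGroup) [N.Normal] [N.FiniteIndex] :
    ∃ n, (levelStab n).subgroupOf grigorchukGroup ≤ N := by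
  have hne : N ≠ ⊥ := by
    rintro rfl
    have : Finite (grigorchukGroup ⧸ (⊥ : Subgroup grigorchukGroup)) := inferInstance
    have : Finite grigorchukGroup :=
      Finite.of_equiv _ (QuotientGroup.quotientBot (G := grigorchukGroup)).toEquiv
    exact not_finite_iff_infinite.2 infinite_grigorchuk this
  obtain ⟨⟨g, hgN⟩, hg⟩ := N.ne_bot_iff_exists_ne_one.1 hne
  have hg' : g.1 ≠ 1 := fun h => hg (Subtype.ext (Subtype.ext h))
  obtain ⟨m, hm⟩ := isBranchPair_grigorchuk.exists_levelStab_le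
    (N := N.map grigorchukGroup.subtype) (by
      rintro g hg _ ⟨x, hx, rfl⟩
      exact ⟨⟨g, hg⟩ * x * ⟨g, hg⟩⁻¹, ‹N.Normal›.conj_mem x hx _, rfl⟩) ⟨g, hgN, rfl⟩ hg'
  refine ⟨m, fun x hx => ?_⟩
  obtain ⟨y, hy, hxy⟩ := hm ⟨x.2, hx⟩
  rwa [← Subtype.ext hxy]

open CategoryTheory in
/-- The inclusion of the Grigorchuk group into `Aut(T_2)` as a morphism to a profinite group. -/
def grigorchukInclusion :
    GrpCat.of grigorchukGroup ⟶ GrpCat.of (ProfiniteGrp.of BinAut) :=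
  GrpCat.ofHom grigorchukGroup.subtype

/-- The extension of the inclusion of the Grigorchuk group to its profinite completion. -/
noncomputable def completionHom : grigorchukCompletion →* BinAut :=
  (ProfiniteGrp.ProfiniteCompletion.lift grigorchukInclusion).hom.toMonoidHom

theorem continuous_completionHom : Continuous completionHom :=
  (ProfiniteGrp.ProfiniteCompletion.lift grigorchukInclusion).hom.continuous_toFun

theorem completionHom_apply (g : grigorchukGroup) :
    completionHom (toGrigorchukCompletion g) = g := by
  have h := ProfiniteGrp.ProfiniteCompletion.lift_eta grigorchukInclusion
  exact CategoryTheory.ConcreteCategory.congr_hom h g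

theorem dense_toGrigorchukCompletion : DenseRange toGrigorchukCompletion :=
  ProfiniteGrp.ProfiniteCompletion.denseRange (GrpCat.of grigorchukGroup)

/-- The value of an element of the completion in a finite quotient. -/
noncomputable def completionProj (N : FiniteIndexNormalSubgroup grigorchukGroup)
    (x : grigorchukCompletion) : grigorchukGroup ⧸ N.toSubgroup := x.1 N

theorem isOpen_completionProj (N : FiniteIndexNormalSubgroup grigorchukGroup)
    (q : grigorchukGroup ⧸ N.toSubgroup) : IsOpen {x | completionProj N x = q} := by
  have hc : Continuous fun x : grigorchukCompletion => x.1 N :=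
    (continuous_apply N).comp continuous_subtype_val
  have : DiscreteTopology ((ProfiniteGrp.ProfiniteCompletion.diagram
    (GrpCat.of grigorchukGroup)).obj N) := ⟨rfl⟩
  exact (isOpen_discrete (α := (ProfiniteGrp.ProfiniteCompletion.diagram
    (GrpCat.of grigorchukGroup)).obj N) {q}).preimage hc

theorem completionHom_injective : Function.Injective completionHom := by
  rw [injective_iff_map_eq_one]
  intro x hx
  refine Subtype.ext (funext fun N => ?_)
  obtain ⟨n, hn⟩ := exists_levelStab_subgroupOf_le N.toSubgroup
  have ho : IsOpen ({y | completionProj N y = completionProj N x} ∩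
      completionHom ⁻¹' (levelStab n : Set BinAut)) :=
    (isOpen_completionProj N _).inter ((isOpen_levelStab n).preimage continuous_completionHom)
  obtain ⟨g, hg1, hg2⟩ := dense_toGrigorchukCompletion.exists_mem_open ho
    ⟨x, rfl, by rw [Set.mem_preimage, hx]; exact one_mem _⟩
  rw [Set.mem_preimage, completionHom_apply] at hg2
  have hgN : g ∈ N.toSubgroup := hn hg2
  exact hg1.symm.trans ((QuotientGroup.eq_one_iff g).2 hgN)

theorem isClosedEmbedding_completionHom : IsClosedEmbedding completionHom :=
  continuous_completionHom.isClosedEmbedding completionHom_injective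

theorem range_completionHom : completionHom.range = grigBar := by
  refine le_antisymm ?_ ?_
  · rintro _ ⟨x, rfl⟩
    have h := map_mem_closure continuous_completionHom (dense_toGrigorchukCompletion x)
      (t := (grigorchukGroup : Set BinAut)) (by
        rintro _ ⟨g, rfl⟩
        rw [completionHom_apply]
        exact g.2)
    exact h
  · refine Subgroup.topologicalClosure_minimal _ ?_ isClosedEmbedding_completionHom.isClosed_range
    intro g hg
    exact ⟨toGrigorchukCompletion ⟨g, hg⟩, completionHom_apply _⟩

/-! ### The branch structure of the completion -/

theorem IsBranchPair.levelStab_inf_le_levelProd {Γ κ : Subgroup BinAut} (h : IsBranchPair Γ κ)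
    {n : ℕ} {g : BinAut} (hg : g ∈ Γ) (hgn : g ∈ levelStab (n + 3)) :
    ∃ f : List Bool → BinAut, (∀ l, f l ∈ κ) ∧ levelProd n f = g := by
  obtain ⟨f, hf, rfl⟩ := h.selfSimilar.exists_levelProd hg hgn
  exact ⟨f, fun l => h.levelStab_three _ (hf l).1 (hf l).2, rfl⟩

theorem mem_rist_vertexOf {Γ : Type*} [Group Γ] {φ : Γ →* BinAut} {l : List Bool} {g : Γ} :
    g ∈ rist φ (vertexOf l) ↔ ∃ h, φ g = atVertex l h :=
  fixes_not_below_iff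

theorem atVertex_mem_grigBar (l : List Bool) {k : BinAut} (hk : k ∈ grigKBar) :
    atVertex l k ∈ grigBar :=
  isBranchPair_grigBar.le (atVertex_mem isBranchPair_grigBar.atLetter_mem l hk)

/-- The preimage of a level stabilizer under a homomorphism has finite index. -/
theorem finiteIndex_comap_levelStab {Γ : Type*} [Group Γ] (φ : Γ →* BinAut) (n : ℕ) :
    ((levelStab n).comap φ).FiniteIndex := by
  have : (levelStab n).FiniteIndex := Subgroup.finiteIndex_of_finite_quotient
  refine ⟨?_⟩
  rw [Subgroup.index_comap]
  exact (inferInstance : ((levelStab n).subgroupOf φ.range).FiniteIndex).index_ne_zero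

/-- The rigid level stabilizers contain congruence subgroups, since the closure is regular branch.
-/
theorem isBranchEmbedding {Γ : Type*} [Group Γ] [TopologicalSpace Γ] {φ : Γ →* BinAut}
    (hφ : IsClosedEmbedding φ) (hr : φ.range = grigBar) : IsBranchEmbedding φ where
  isClosedEmbedding := hφ
  transitive := fun v w h => by
    obtain ⟨g, hg, hgv⟩ := grigorchuk_transitive v w h
    obtain ⟨x, rfl⟩ : g ∈ φ.range := hr ▸ grigorchuk_le_grigBar hg
    exact ⟨x, hgv⟩
  finiteIndex_ristLevel := fun n => by
    have := finiteIndex_comap_levelStab φ (n + 3)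
    refine Subgroup.finiteIndex_of_le (H := (levelStab (n + 3)).comap φ) fun g hg => ?_
    have hgr : φ g ∈ grigBar := hr ▸ ⟨g, rfl⟩
    obtain ⟨f, hf, hfg⟩ := isBranchPair_grigBar.levelStab_inf_le_levelProd hgr hg
    have hmem : levelProd n f ∈ (ristLevel φ n).map φ := levelProd_mem fun l hl => by
      have h1 := atVertex_mem_grigBar l (hf l)
      rw [← hr] at h1
      obtain ⟨y, hy⟩ := h1
      have hyr : y ∈ rist φ (vertexOf l) := mem_rist_vertexOf.2 ⟨_, hy⟩
      exact ⟨y, le_iSup (fun v : {v : Vertex binary // v.level = n} => rist φ v.1)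
        ⟨vertexOf l, by rw [level_vertexOf, hl]⟩ hyr, hy⟩
    rw [hfg] at hmem
    obtain ⟨y, hy, hyg⟩ := hmem
    rwa [← hφ.injective hyg]

/-! ### Derangements -/

theorem levelProd_act_ne {m : ℕ} {h : List Bool → BinAut} (hh : ∀ l, h l ∉ levelStab 1)
    {v : Vertex binary} (hv : v.level = m + 1) : (levelProd m h).1 v ≠ v := by
  induction m generalizing h v with
  | zero =>
    obtain ⟨p, q, hpq | hpq⟩ := exists_pair_or (h [])
    · exact absurd (by rw [hpq, ← zero_add 1, pair_mem_levelStab]; simp) (hh [])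
    · obtain ⟨i, w, hw, rfl⟩ := level_eq_succ.1 hv
      rw [levelProd_zero, hpq]
      cases i <;> simp
  | succ m ih =>
    obtain ⟨_ | _, w, hw, rfl⟩ := level_eq_succ.1 hv
    · simpa using ih (fun l => hh _) hw
    · simpa using ih (fun l => hh _) hw

/-- The product of copies of `(ab)²` over level `n` swaps all pairs of siblings of level `n + 2`. -/
theorem exists_levelProd_gx (n : ℕ) : ∃ h : List Bool → BinAut, (∀ l, h l ∉ levelStab 1) ∧
    levelProd (n + 1) h = levelProd n fun _ => gx := by
  have hpair : ∀ p q, pair p q ∈ levelStab 1 := fun p q => by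
    rw [← zero_add 1, pair_mem_levelStab]; simp
  induction n with
  | zero =>
    refine ⟨fun l => match l with
      | [false] => gc * ga
      | _ => ga * gc, fun l => ?_, ?_⟩
    · have h1 : gc * ga ∉ levelStab 1 := fun h => ga_notMem_levelStab 0
        (((levelStab 1).mul_mem_cancel_left (by rw [gc_eq]; exact hpair _ _)).1 h)
      have h2 : ga * gc ∉ levelStab 1 := fun h => ga_notMem_levelStab 0
        (((levelStab 1).mul_mem_cancel_right (by rw [gc_eq]; exact hpair _ _)).1 h)
      beta_reduce
      split <;> assumption
    · simp [gx_eq]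
  | succ n ih =>
    obtain ⟨h, hh, he⟩ := ih
    refine ⟨fun l => h l.tail, fun l => hh _, ?_⟩
    rw [levelProd_succ (n + 1), levelProd_succ n fun _ => gx]
    exact congrArg₂ pair he he

theorem levelProd_gx_mem (n : ℕ) : levelProd n (fun _ => gx) ∈ grigorchukGroup :=
  levelProd_mem fun l _ => grigK_le (atVertex_mem (fun i _ hk => atLetter_mem_grigK i hk) l gx_mem)

theorem levelProd_gx_mem_levelStab (n : ℕ) : levelProd n (fun _ => gx) ∈ levelStab n :=
  levelProd_mem_levelStab (m := 0) fun l => by simp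

theorem locallyHasDerangements {Γ : Type*} [Group Γ] {φ : Γ →* BinAut}
    (hr : φ.range = grigBar) : LocallyHasDerangements φ := fun n => by
  obtain ⟨x, hx⟩ : levelProd n (fun _ => gx) ∈ φ.range :=
    hr ▸ grigorchuk_le_grigBar (levelProd_gx_mem n)
  refine ⟨n + 2, by omega, x, ?_, ?_⟩
  · rw [hx]
    exact levelProd_gx_mem_levelStab n
  · intro v hv
    obtain ⟨h, hh, he⟩ := exists_levelProd_gx n
    rw [hx, ← he]
    exact levelProd_act_ne hh hv

/-! ### Commutator widths -/

section Width

theorem commutatorsIn_mono {G : Type*} [Group G] {κ κ' : Subgroup G} (h : κ ≤ κ') :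
    commutatorsIn κ ⊆ commutatorsIn κ' := by
  rintro _ ⟨k, hk, k', hk', rfl⟩
  exact ⟨k, h hk, k', h hk', rfl⟩

theorem one_mem_commutatorsIn {G : Type*} [Group G] (κ : Subgroup G) :
    (1 : G) ∈ commutatorsIn κ := ⟨1, one_mem _, 1, one_mem _, by simp⟩

theorem image_commutatorsIn {G H : Type*} [Group G] [Group H] (f : G →* H) (κ : Subgroup G) :
    f '' commutatorsIn κ = commutatorsIn (κ.map f) := by
  ext z
  constructor
  · rintro ⟨_, ⟨k, hk, k', hk', rfl⟩, rfl⟩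
    exact ⟨f k, ⟨k, hk, rfl⟩, f k', ⟨k', hk', rfl⟩, (map_commutatorElement f k k').symm⟩
  · rintro ⟨_, ⟨k, hk, rfl⟩, _, ⟨k', hk', rfl⟩, rfl⟩
    exact ⟨_, ⟨k, hk, k', hk', rfl⟩, map_commutatorElement f k k'⟩

theorem exists_mem_pow_commutatorsIn {G : Type*} [Group G] {κ : Subgroup G} {z : G}
    (hz : z ∈ ⁅κ, κ⁆) : ∃ n, z ∈ commutatorsIn κ ^ n := by
  rw [Subgroup.commutator_def] at hz
  induction hz using Subgroup.closure_induction with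
  | mem z hz => exact ⟨1, by rw [pow_one]; exact hz⟩
  | one => exact ⟨0, by simp⟩
  | mul z w _ _ ihz ihw =>
    obtain ⟨n, hn⟩ := ihz
    obtain ⟨m, hm⟩ := ihw
    exact ⟨n + m, by rw [pow_add]; exact Set.mul_mem_mul hn hm⟩
  | inv z _ ih =>
    obtain ⟨n, hn⟩ := ih
    have hinv : (commutatorsIn κ)⁻¹ = commutatorsIn κ := by
      have : (commutatorsIn κ)⁻¹ ⊆ commutatorsIn κ := by
        rintro z ⟨k, hk, k', hk', h⟩
        exact ⟨k', hk', k, hk, by rw [← commutatorElement_inv, h, inv_inv]⟩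
      exact this.antisymm (by simpa using Set.inv_subset_inv.2 this)
    exact ⟨n, by rw [← hinv, inv_pow]; exact Set.inv_mem_inv.2 hn⟩

theorem commutatorLength_le_of_mem_pow {G : Type*} [Group G] {n : ℕ} {z : G}
    (hz : z ∈ commutatorsIn (⊤ : Subgroup G) ^ n) : commutatorLength z ≤ n := by
  have : ∃ l : List (G × G), (l.map fun p => p.1 * p.2 * p.1⁻¹ * p.2⁻¹).prod = z ∧
      l.length = n := by
    induction n generalizing z with
    | zero => exact ⟨[], by simpa [eq_comm] using hz, rfl⟩
    | succ n ih =>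
      rw [pow_succ'] at hz
      obtain ⟨_, ⟨k, -, k', -, rfl⟩, w, hw, rfl⟩ := hz
      obtain ⟨l, rfl, hl⟩ := ih hw
      exact ⟨(k, k') :: l, by simp [commutatorElement_def], by simp [hl]⟩
  obtain ⟨l, hl, rfl⟩ := this
  exact iInf₂_le l hl

theorem pow_subset_pow_commutatorsIn {G : Type*} [Group G] (κ : Subgroup G) {n m : ℕ}
    (h : n ≤ m) : commutatorsIn κ ^ n ⊆ commutatorsIn κ ^ m :=
  Set.pow_subset_pow_right (one_mem_commutatorsIn κ) h

/-- The groups between the closures of `K` and of the Grigorchuk group have uniformly bounded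
commutator width. Such a group `S` contains the seventh congruence subgroup, so it is determined by
its image in a finite quotient, and elements of `[S, S]` with the same image differ by a product of
`64` commutators. -/
theorem exists_commutator_bound : ∃ M, ∀ S : Subgroup BinAut, grigKBar ≤ S → S ≤ grigBar →
    ∀ s ∈ ⁅S, S⁆, s ∈ commutatorsIn S ^ M := by
  let π : BinAut → BinAut ⧸ levelStab 7 := QuotientGroup.mk
  have key : ∀ p : Set (BinAut ⧸ levelStab 7) × (BinAut ⧸ levelStab 7), ∃ n : ℕ,
      ∀ S : Subgroup BinAut, grigKBar ≤ S → S ≤ grigBar → ∀ s ∈ ⁅S, S⁆,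
        (π '' S, π s) = p → s ∈ commutatorsIn S ^ n := fun p => by
    by_cases hp : ∃ S : Subgroup BinAut, grigKBar ≤ S ∧ S ≤ grigBar ∧ ∃ s ∈ ⁅S, S⁆,
        (π '' S, π s) = p
    · obtain ⟨S, hKS, hS, s, hs, rfl⟩ := hp
      obtain ⟨n, hn⟩ := exists_mem_pow_commutatorsIn hs
      refine ⟨n + 64, fun S' hKS' hS' s' hs' he => ?_⟩
      obtain ⟨he1, he2⟩ := Prod.mk.inj he
      have hEK : grigBar ⊓ levelStab 7 ≤ grigKBar := fun g hg =>
        isBranchPair_grigBar.levelStab_three g hg.1 (levelStab_antitone (by norm_num) hg.2)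
      have hsub : ∀ S S' : Subgroup BinAut, grigKBar ≤ S → S ≤ grigBar → S' ≤ grigBar →
          π '' S' = π '' S → S' ≤ S := fun S S' hKS hS hS' he r hr => by
        obtain ⟨t, ht, htr⟩ : π r ∈ π '' S := he ▸ ⟨r, hr, rfl⟩
        have h1 : t⁻¹ * r ∈ levelStab 7 := QuotientGroup.eq.1 htr
        have h2 : t⁻¹ * r ∈ grigBar := mul_mem (inv_mem (hS ht)) (hS' hr)
        have h3 := mul_mem ht (hKS (hEK ⟨h2, h1⟩))
        rwa [mul_inv_cancel_left] at h3
      obtain rfl : S' = S := le_antisymm (hsub S S' hKS hS hS' he1) (hsub S' S hKS' hS' hS he1.symm)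
      have h1 : s⁻¹ * s' ∈ levelStab 7 := QuotientGroup.eq.1 he2.symm
      have hSS : ⁅S', S'⁆ ≤ S' := Subgroup.commutator_le_self S'
      have h2 : s⁻¹ * s' ∈ grigBar := mul_mem (inv_mem (hS (hSS hs))) (hS (hSS hs'))
      have h3 : s⁻¹ * s' ∈ commutatorsIn S' ^ 64 :=
        Set.pow_subset_pow_left (commutatorsIn_mono hKS) (levelStab_subset_pow ⟨h2, h1⟩)
      have h4 := Set.mul_mem_mul hn h3
      rwa [mul_inv_cancel_left, ← pow_add] at h4
    · push Not at hp
      exact ⟨0, fun S hKS hS s hs he => absurd he (hp S hKS hS s hs)⟩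
  choose n hn using key
  obtain ⟨M, hM⟩ := Set.Finite.bddAbove (Set.finite_range n)
  exact ⟨M, fun S hKS hS s hs =>
    pow_subset_pow_commutatorsIn S (hM ⟨_, rfl⟩) (hn _ S hKS hS s hs rfl)⟩

/-- The rigid stabilizer of the vertex `l` is isomorphic to a group between the closures of `K` and
of the Grigorchuk group, so that `exists_commutator_bound` applies to all of them at once. -/
theorem hasUniformCommutatorWidths {Γ : Type*} [Group Γ] {φ : Γ →* BinAut}
    (hinj : Function.Injective φ) (hr : φ.range = grigBar) : HasUniformCommutatorWidths φ := by
  obtain ⟨M, hM⟩ := exists_commutator_bound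
  refine lt_of_le_of_lt (iSup_le fun v => ?_) (ENat.natCast_lt_top M)
  obtain ⟨l, rfl⟩ := exists_vertexOf v
  set S := grigBar.comap (atVertex l) with hS
  set F := φ.comp (rist φ (vertexOf l)).subtype with hF
  have hFinj : Function.Injective F := hinj.comp Subtype.val_injective
  have hmap : (⊤ : Subgroup (rist φ (vertexOf l))).map F = S.map (atVertex l) := by
    ext z
    constructor
    · rintro ⟨⟨x, hx⟩, -, rfl⟩
      obtain ⟨h, hh⟩ := mem_rist_vertexOf.1 hx
      refine ⟨h, ?_, hh.symm⟩
      rw [SetLike.mem_coe, hS, Subgroup.mem_comap, ← hh, ← hr]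
      exact ⟨x, rfl⟩
    · rintro ⟨h, hh, rfl⟩
      rw [SetLike.mem_coe, hS, Subgroup.mem_comap, ← hr] at hh
      obtain ⟨x, hx⟩ := hh
      exact ⟨⟨x, mem_rist_vertexOf.2 ⟨h, hx⟩⟩, trivial, hx⟩
  have hKS : grigKBar ≤ S := fun k hk => atVertex_mem_grigBar l hk
  have hSG : S ≤ grigBar := fun s hs => isBranchPair_grigBar.selfSimilar.of_atVertex hs
  refine iSup_le fun g => commutatorLength_le_of_mem_pow ?_
  have hg : F g ∈ (⁅S, S⁆ : Subgroup BinAut).map (atVertex l) := by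
    rw [Subgroup.map_commutator, ← hmap, ← Subgroup.map_commutator]
    exact Subgroup.mem_map_of_mem F g.2
  obtain ⟨s, hs, hsg⟩ := hg
  have h1 : F g ∈ atVertex l '' (commutatorsIn S ^ M) := ⟨s, hM S hKS hSG s hs, hsg⟩
  rw [Set.image_pow, image_commutatorsIn, ← hmap, ← image_commutatorsIn, ← Set.image_pow] at h1
  obtain ⟨g', hg', he⟩ := h1
  rwa [← hFinj he]

end Width

/-! ### Strong just infiniteness -/

theorem isOpen_of_comap_levelStab_le {Γ : Type*} [Group Γ] [TopologicalSpace Γ]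
    [IsTopologicalGroup Γ] {φ : Γ →* BinAut} (hφ : Continuous φ) {N : Subgroup Γ} {m : ℕ}
    (h : (levelStab m).comap φ ≤ N) : IsOpen (N : Set Γ) :=
  Subgroup.isOpen_mono h ((isOpen_levelStab m).preimage hφ)

theorem stronglyJustInfinite {Γ : Type*} [Group Γ] [TopologicalSpace Γ]
    [IsTopologicalGroup Γ] {φ : Γ →* BinAut} (hφ : IsClosedEmbedding φ)
    (hr : φ.range = grigBar) : StronglyJustInfinite Γ := fun N hN hne => by
  obtain ⟨⟨g, hgN⟩, hg⟩ := N.ne_bot_iff_exists_ne_one.1 hne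
  obtain ⟨m, hm⟩ := isBranchPair_grigBar.exists_levelStab_le (N := N.map φ) (by
    intro g hg
    rw [← hr] at hg
    obtain ⟨y, rfl⟩ := hg
    rintro _ ⟨x, hx, rfl⟩
    exact ⟨y * x * y⁻¹, hN.conj_mem x hx y, by simp⟩) ⟨g, hgN, rfl⟩ (fun h => hg (by
      rw [← map_one φ] at h
      exact Subtype.ext (hφ.injective h)))
  have hle : (levelStab m).comap φ ≤ N := fun x hx => by
    have h1 : φ x ∈ grigBar := hr ▸ ⟨x, rfl⟩
    obtain ⟨y, hy, hyx⟩ := hm ⟨h1, hx⟩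
    rwa [← hφ.injective hyx]
  have := finiteIndex_comap_levelStab φ m
  exact ⟨isOpen_of_comap_levelStab_le hφ.continuous hle, Subgroup.finiteIndex_of_le hle⟩

/-! ### Products along an infinite ray -/

/-- The partial products of `rayProd`. -/
def rayApprox : ℕ → (ℕ → BinAut) → BinAut
  | 0, _ => 1
  | n + 1, k => pair (k 0) (rayApprox n fun i => k (i + 1))

theorem rayApprox_act {m : ℕ} (k : ℕ → BinAut) {v : Vertex binary} (h : v.level ≤ m) :
    (rayApprox m k).1 v = (rayApprox v.level k).1 v := by
  induction v using vertex_induction generalizing m k with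
  | hr => rw [act_root, act_root]
  | hc i v ih =>
    obtain _ | m := m
    · simp at h
    rw [level_cons]
    rcases i with _ | _
    · rfl
    · exact congrArg (cons true) (ih _ (by simpa using h))

/-- The infinite product of the automorphisms `k i`, acting below the vertices `1^i 0`. -/
def rayProd (k : ℕ → BinAut) : BinAut where
  val :=
    { toFun := fun v => (rayApprox v.level k).1 v
      invFun := fun v => ((rayApprox v.level k)⁻¹).1 v
      left_inv := fun v => by
        beta_reduce
        rw [level_act, inv_act_act]
      right_inv := fun v => by
        beta_reduce
        rw [level_act, act_inv_act] }
  property := fun v => by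
    change (rayApprox v.parent.level k).1 v.parent = ((rayApprox v.level k).1 v).parent
    rw [← act_parent, rayApprox_act (m := v.level) k (by rw [level_parent]; omega)]

theorem rayProd_act (k : ℕ → BinAut) (v : Vertex binary) :
    (rayProd k).1 v = (rayApprox v.level k).1 v := rfl

theorem rayProd_eq (k : ℕ → BinAut) : rayProd k = pair (k 0) (rayProd fun i => k (i + 1)) :=
  binAut_ext' (fun _ => rfl) (fun _ => rfl)

theorem rayProd_mem {k : ℕ → BinAut} (hk : ∀ i, k i ∈ grigKBar) : rayProd k ∈ grigKBar := by
  have happrox : ∀ n (k : ℕ → BinAut), (∀ i, k i ∈ grigKBar) → rayApprox n k ∈ grigKBar :=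
    fun n => by
      induction n with
      | zero => exact fun _ _ => one_mem _
      | succ n ih =>
        intro k hk
        have h1 := isBranchPair_grigBar.atLetter_mem false _ (hk 0)
        have h2 := isBranchPair_grigBar.atLetter_mem true _ (ih _ fun i => hk (i + 1))
        simpa [rayApprox] using mul_mem h1 h2
  have hcl : rayProd k ∈ closure (grigKBar : Set BinAut) :=
    mem_closure_iff_levelStab.2 fun n => ⟨rayApprox n k, happrox n k hk, fun v hv => by
      rw [mul_act, rayProd_act, hv, inv_act_act]⟩
  rwa [isClosed_grigKBar.closure_eq] at hcl

/-- The vertex `1^i 0`. -/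
def rayVertex : ℕ → List Bool
  | 0 => [false]
  | i + 1 => true :: rayVertex i

theorem rayProd_decomp (k : ℕ → BinAut) (i : ℕ) :
    ∃ t, (∀ g, Commute t (atVertex (rayVertex i) g)) ∧
      rayProd k = atVertex (rayVertex i) (k i) * t := by
  induction i generalizing k with
  | zero =>
    refine ⟨pair 1 (rayProd fun i => k (i + 1)), fun g => ?_, ?_⟩
    · simp [rayVertex, Commute, SemiconjBy]
    · rw [rayProd_eq]
      simp [rayVertex]
  | succ i ih =>
    obtain ⟨t, ht, he⟩ := ih fun i => k (i + 1)
    refine ⟨pair (k 0) t, fun g => ?_, ?_⟩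
    · simp [rayVertex, Commute, SemiconjBy, (ht g).eq]
    · rw [rayProd_eq, he]
      simp [rayVertex]

/-! ### Syndetic sets: commutators below some vertex -/

/-- If countably many translates of `B` cover the closure of the Grigorchuk group, then `B⁻¹ B`
contains elements with arbitrary restriction in `K` to some vertex of a given ray. Otherwise a
product along the ray of elements that each avoid one translate would avoid all of them. -/
theorem exists_ray_full {B : Set BinAut} {h : ℕ → BinAut}
    (hcov : ∀ g ∈ grigBar, ∃ i, ∃ β ∈ B, g = h i * β) (p : List Bool) :
    ∃ w : List Bool, ∀ x ∈ grigKBar, ∃ t, (∀ g, Commute t (atVertex w g)) ∧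
      atVertex p (atVertex w x * t) ∈ B⁻¹ * B := by
  obtain ⟨i, hi⟩ : ∃ i, ∀ x ∈ grigKBar, ∃ k : ℕ → BinAut, k i = x ∧
      ∃ β ∈ B, atVertex p (rayProd k) = h i * β := by
    by_contra! H
    choose x hx hxk using H
    obtain ⟨i, β, hβ, he⟩ := hcov _ (atVertex_mem_grigBar p (rayProd_mem hx))
    exact hxk i x rfl β hβ he
  refine ⟨rayVertex i, fun x hx => ?_⟩
  obtain ⟨k, hk, β, hβ, he⟩ := hi x hx
  obtain ⟨k', hk', β', hβ', he'⟩ := hi 1 (one_mem _)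
  obtain ⟨t, ht, hd⟩ := rayProd_decomp k i
  obtain ⟨t', ht', hd'⟩ := rayProd_decomp k' i
  refine ⟨t'⁻¹ * t, fun g => ((ht' g).inv_left).mul_left (ht g), ?_⟩
  have e : atVertex p (atVertex (rayVertex i) x * (t'⁻¹ * t)) = β'⁻¹ * β := by
    have e1 : β'⁻¹ * β = (atVertex p (rayProd k'))⁻¹ * atVertex p (rayProd k) := by
      rw [he, he']; group
    rw [e1, ← map_inv, ← map_mul, hd, hd', hk, hk', map_one, one_mul, ← mul_assoc, ← mul_assoc,
      ((ht' x).inv_left).eq]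
  rw [e]
  exact Set.mul_mem_mul (Set.inv_mem_inv.2 hβ') hβ

/-- Applying `exists_ray_full` along a ray below `p`, and again along a ray below the vertex found,
gives two kinds of elements of `B²` whose commutators are supported below a single vertex. -/
theorem exists_commutators_mem_pow {B : Set BinAut} (hB : B⁻¹ = B) {h : ℕ → BinAut}
    (hcov : ∀ g ∈ grigBar, ∃ i, ∃ β ∈ B, g = h i * β) (p : List Bool) :
    ∃ w : List Bool, ∀ z ∈ commutatorsIn grigKBar, atVertex (p ++ w) z ∈ B ^ 8 := by
  obtain ⟨u, hu⟩ := exists_ray_full hcov p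
  obtain ⟨w, hw⟩ := exists_ray_full hcov (p ++ u)
  refine ⟨u ++ w, ?_⟩
  rintro _ ⟨x, hx, y, hy, rfl⟩
  -- the two elements commute except for their parts below `p ++ u ++ w`
  obtain ⟨t, ht, h1⟩ := hu (atVertex w x) (atVertex_mem isBranchPair_grigBar.atLetter_mem w hx)
  obtain ⟨t', ht', h2⟩ := hw y hy
  rw [hB, ← pow_two] at h1 h2
  have hinv : ∀ z ∈ B ^ 2, z⁻¹ ∈ B ^ 2 := fun z hz => by
    rw [← hB, inv_pow]
    exact Set.inv_mem_inv.2 hz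
  have h3 : atVertex (p ++ (u ++ w)) ⁅x, y⁆ =
      ⁅atVertex p (atVertex u (atVertex w x) * t), atVertex (p ++ u) (atVertex w y * t')⁆ := by
    rw [atVertex_append, atVertex_append, atVertex_append p u, ← map_commutatorElement]
    congr 1
    have e1 : ∀ X t Y : BinAut, Commute t Y → ⁅X * t, Y⁆ = ⁅X, Y⁆ := fun X t Y h => by
      rw [commutatorElement_def, commutatorElement_def, mul_assoc X, h.eq]
      group
    have e2 : ∀ X t Y : BinAut, Commute t X → ⁅X, Y * t⁆ = ⁅X, Y⁆ := fun X t Y h => by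
      rw [← commutatorElement_inv, e1 _ _ _ h, commutatorElement_inv]
    rw [e1 _ _ _ (ht _), ← map_commutatorElement, e2 _ _ _ (ht' _), ← map_commutatorElement]
  rw [h3, commutatorElement_def, show 8 = 2 + 2 + 2 + 2 from rfl, pow_add, pow_add, pow_add]
  exact Set.mul_mem_mul (Set.mul_mem_mul (Set.mul_mem_mul h1 h2) (hinv _ h1)) (hinv _ h2)

theorem exists_levelStab_mem_pow {B : Set BinAut} (hB : B⁻¹ = B) {h : ℕ → BinAut}
    (hcov : ∀ g ∈ grigBar, ∃ i, ∃ β ∈ B, g = h i * β) (p : List Bool) :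
    ∃ w : List Bool, ∀ z ∈ grigBar ⊓ levelStab 7, atVertex (p ++ w) z ∈ B ^ 512 := by
  obtain ⟨w, hw⟩ := exists_commutators_mem_pow hB hcov p
  refine ⟨w, fun z hz => ?_⟩
  have h1 : atVertex (p ++ w) z ∈ atVertex (p ++ w) '' (commutatorsIn grigKBar ^ 64) :=
    ⟨z, levelStab_subset_pow hz, rfl⟩
  rw [Set.image_pow] at h1
  have h2 : atVertex (p ++ w) '' commutatorsIn grigKBar ⊆ B ^ 8 := by
    rintro _ ⟨z, hz, rfl⟩
    exact hw z hz
  have h3 := Set.pow_subset_pow_left h2 h1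
  rwa [← pow_mul] at h3

/-- The form of the weak Steinhaus property for subsets of the closure of the Grigorchuk group. The
elements of `B²` approximate all elements of a level stabilizer, which moves the vertex found in
`exists_levelStab_mem_pow` to all other vertices of its level below a given vertex. -/
theorem exists_levelStab_subset_pow {B : Set BinAut} (hBG : B ⊆ grigBar) (hB : B⁻¹ = B)
    {h : ℕ → BinAut} (hcov : ∀ g ∈ grigBar, ∃ i, ∃ β ∈ B, g = h i * β) {n : ℕ}
    (happ : ∀ g ∈ grigBar ⊓ levelStab n, ∀ m, ∃ β ∈ B ^ 2, β⁻¹ * g ∈ levelStab m) :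
    ∃ k m, ((grigBar ⊓ levelStab m : Subgroup BinAut) : Set BinAut) ⊆ B ^ k := by
  have hb := isBranchPair_grigBar
  choose w hw using exists_levelStab_mem_pow hB hcov
  have hB2 : B ^ 2 ⊆ grigBar := by
    rw [pow_two]
    rintro _ ⟨x, hx, y, hy, rfl⟩
    exact mul_mem (hBG hx) (hBG hy)
  have hinv : ∀ z ∈ B ^ 2, z⁻¹ ∈ B ^ 2 := fun z hz => by
    rw [← hB, inv_pow]
    exact Set.inv_mem_inv.2 hz
  -- below any vertex `u` of level `n + 3`, the vertex `u w(u)` can be replaced by `u r`: the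
  -- section at the last three letters of `u` lifts to an element of `K`, so that the element
  -- moving `w(u)` to `r` is realized in the stabilizer of level `n`, where it is approximated
  -- by an element of `B²`
  have hmove : ∀ u r : List Bool, u.length = n + 3 → r.length = (w u).length →
      ∀ y ∈ grigBar ⊓ levelStab 7, atVertex (u ++ r) y ∈ B ^ 516 := fun u r hu hr y hy => by
    obtain ⟨u', l, rfl, hu', hl⟩ : ∃ u' l, u = u' ++ l ∧ u'.length = n ∧ l.length = 3 :=
      ⟨u.take n, u.drop n, (List.take_append_drop n u).symm, by simp [hu], by simp [hu]⟩
    obtain ⟨s, hs, hsc⟩ := exists_carries hr.symm (one_mem _)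
    obtain ⟨t, ht, htc⟩ := liftsToK_three hs l hl
    have htn : atVertex u' t ∈ levelStab n := by
      have := atVertex_mem_levelStab (l := u') (g := t) (n := 0) (by simp)
      simpa [hu'] using this
    have htG : atVertex u' t ∈ grigBar := atVertex_mem_grigBar u' (grigK_le_grigKBar ht)
    obtain ⟨β, hβ, hβt⟩ := happ _ ⟨htG, htn⟩ ((u' ++ l ++ w (u' ++ l)).length + 0)
    obtain ⟨f, hf, hfe⟩ := hb.selfSimilar.exists_levelProd
      (grigBar.mul_mem (grigBar.inv_mem (hB2 hβ)) htG) hβt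
    have h1 : ∀ y, atVertex u' t * atVertex (u' ++ l ++ w (u' ++ l)) y * (atVertex u' t)⁻¹ =
        atVertex (u' ++ l ++ r) y := fun y => by
      simp only [atVertex_append, ← map_mul, ← map_inv]
      rw [htc, hsc]
      simp
    set c := f (u' ++ l ++ w (u' ++ l)) with hc
    have h2 : atVertex (u' ++ l ++ r) y =
        β * atVertex (u' ++ l ++ w (u' ++ l)) (c * y * c⁻¹) * β⁻¹ := by
      rw [← levelProd_conj_atVertex, hfe, ← h1]
      group
    have h3 : c * y * c⁻¹ ∈ grigBar ⊓ levelStab 7 :=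
      ⟨grigBar.mul_mem (grigBar.mul_mem (hf _).1 hy.1) (grigBar.inv_mem (hf _).1),
        (levelStab_normal 7).conj_mem _ hy.2 _⟩
    rw [h2, show 516 = 2 + 512 + 2 from rfl, pow_add, pow_add]
    exact Set.mul_mem_mul (Set.mul_mem_mul hβ (hw _ _ h3)) (hinv _ hβ)
  -- finitely many vertices `u` suffice, so the lengths of the `w(u)` are bounded
  obtain ⟨M, hM⟩ : ∃ M, ∀ u : List Bool, u.length = n + 3 → (w u).length ≤ M := by
    obtain ⟨M, hM⟩ := ((List.finite_length_eq Bool (n + 3)).image fun u => (w u).length).bddAbove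
    exact ⟨M, fun u hu => hM ⟨u, hu, rfl⟩⟩
  refine ⟨516 * 2 ^ (n + 3 + M), n + 3 + M + 7, ?_⟩
  rintro g ⟨hg, hgm⟩
  obtain ⟨f, hf, rfl⟩ := hb.selfSimilar.exists_levelProd hg hgm
  refine levelProd_mem_pow fun l hl => ?_
  obtain ⟨u, r, r', rfl, hu, hr⟩ : ∃ u r r', l = u ++ r ++ r' ∧ u.length = n + 3 ∧
      r.length = (w u).length := by
    have hu : (l.take (n + 3)).length = n + 3 := by simp [hl]
    refine ⟨l.take (n + 3), (l.drop (n + 3)).take (w (l.take (n + 3))).length,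
      (l.drop (n + 3)).drop (w (l.take (n + 3))).length, by simp, hu, ?_⟩
    have := hM _ hu
    rw [List.length_take, List.length_drop, hl]
    omega
  rw [atVertex_append]
  refine hmove u r hu hr _ ⟨?_, ?_⟩
  · exact atVertex_mem_grigBar _
      (hb.levelStab_three _ (hf _).1 (levelStab_antitone (by norm_num) (hf _).2))
  · exact levelStab_antitone (Nat.le_add_left _ _) (atVertex_mem_levelStab (hf _).2)

/-! ### Conjugation invariant syndetic sets -/

/-- If `e` swaps the vertices of level one, `⁅e, k⁆` has two factors, one below each vertex, and
only one of them fails to commute with `k'`. -/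
theorem commutator_atLetter {e : BinAut} (he : e ∉ levelStab 1) (i : Bool) (k k' : BinAut) :
    ⁅⁅e, atLetter i k⁆, atLetter i k'⁆ = atLetter i ⁅k⁻¹, k'⁆ := by
  obtain ⟨p, q, rfl | rfl⟩ := exists_pair_or e
  · exact absurd (by rw [← zero_add 1, pair_mem_levelStab]; simp) he
  have key : ∀ u w, ⁅pair p q * ga, pair u w⁆ = pair (p * w * p⁻¹ * u⁻¹) (q * u * q⁻¹ * w⁻¹) :=
    fun u w => by
      rw [commutatorElement_def, mul_inv_rev, generator_inv, mul_assoc (pair p q),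
        mul_assoc (pair p q), ← mul_assoc (ga * pair u w), ga_pair_ga]
      simp [mul_assoc]
  cases i <;> simp [key]

/-- A conjugation invariant symmetric set whose square approximates a level stabilizer contains a
level stabilizer in a fixed power. Its square contains an element that moves all vertices of some
level, and commutators with it produce all products over that level of commutators. -/
theorem exists_levelStab_subset_pow_of_invariant {B : Set BinAut} (hB : B⁻¹ = B)
    (hconj : ∀ g ∈ grigBar, ∀ x ∈ B, g * x * g⁻¹ ∈ B) {n : ℕ}
    (happ : ∀ g ∈ grigBar ⊓ levelStab n, ∀ m, ∃ β ∈ B ^ 2, β⁻¹ * g ∈ levelStab m) :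
    ∃ m, ((grigBar ⊓ levelStab m : Subgroup BinAut) : Set BinAut) ⊆ B ^ 1024 := by
  have hb := isBranchPair_grigBar
  have hconj' : ∀ j, ∀ g ∈ grigBar, ∀ x ∈ B ^ j, g * x * g⁻¹ ∈ B ^ j := fun j g hg => by
    have : MulAut.conj g '' B ⊆ B := by
      rintro _ ⟨x, hx, rfl⟩
      exact hconj g hg x hx
    intro x hx
    have h1 : MulAut.conj g x ∈ MulAut.conj g '' (B ^ j) := ⟨x, hx, rfl⟩
    rw [Set.image_pow] at h1
    exact Set.pow_subset_pow_left this h1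
  have hcomm : ∀ j, ∀ g ∈ grigBar, ∀ x ∈ B ^ j, ⁅x, g⁆ ∈ B ^ (j * 2) := fun j g hg x hx => by
    have h1 : x⁻¹ ∈ B ^ j := by
      rw [← hB, inv_pow]
      exact Set.inv_mem_inv.2 hx
    have h2 : ⁅x, g⁆ = x * (g * x⁻¹ * g⁻¹) := by rw [commutatorElement_def]; group
    rw [h2, mul_two, pow_add]
    exact Set.mul_mem_mul hx (hconj' j g hg _ h1)
  -- an element of `B²` agreeing with the product of copies of `(ab)²` up to level `n + 2`
  obtain ⟨β, hβ, hβn⟩ := happ _ ⟨grigorchuk_le_grigBar (levelProd_gx_mem n),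
    levelProd_gx_mem_levelStab n⟩ (n + 1 + 1)
  obtain ⟨e, he, rfl⟩ : ∃ e : List Bool → BinAut, (∀ l, e l ∉ levelStab 1) ∧
      levelProd (n + 1) e = β := by
    obtain ⟨h, hh, hhe⟩ := exists_levelProd_gx n
    obtain ⟨f, hf, hfe⟩ := isSelfSimilar_top.exists_levelProd trivial (inv_mem hβn)
    -- modulo level `n + 2`, the sections of `β` at level `n + 1` are those of the product
    refine ⟨h * f, fun l hl => hh l (((levelStab 1).mul_mem_cancel_right (hf l).2).1 hl), ?_⟩
    rw [map_mul, hhe, hfe]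
    group
  have hG : ∀ i (k : List Bool → BinAut), (∀ l, k l ∈ grigKBar) →
      levelProd (n + 1) (fun l => atLetter i (k l)) ∈ grigBar := fun i k hk =>
    levelProd_mem fun l _ => atVertex_mem_grigBar l (hb.atLetter_mem i _ (hk l))
  have h8 : ∀ i (z : List Bool → BinAut), (∀ l, z l ∈ commutatorsIn grigKBar) →
      levelProd (n + 1) (fun l => atLetter i (z l)) ∈ B ^ 8 := fun i z hz => by
    choose k hk k' hk' hkz using hz
    have h1 := hcomm 4 _ (hG i k' hk') _ (hcomm 2 _ (hG i _ fun l => inv_mem (hk l)) _ hβ)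
    rw [← map_commutatorElement, ← map_commutatorElement] at h1
    convert h1 using 2
    funext l
    have h2 := commutator_atLetter (he l) i (k l)⁻¹ (k' l)
    rw [inv_inv, hkz] at h2
    exact h2.symm
  have hpow : ∀ c i (z : List Bool → BinAut), (∀ l, z l ∈ commutatorsIn grigKBar ^ c) →
      levelProd (n + 1) (fun l => atLetter i (z l)) ∈ (B ^ 8) ^ c := fun c => by
    induction c with
    | zero =>
      intro i z hz
      have : (fun l => atLetter i (z l)) = 1 := funext fun l => by
        have h0 := hz l
        rw [pow_zero] at h0
        rw [Set.mem_one.1 h0, map_one]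
        rfl
      rw [this, map_one, pow_zero]
      exact Set.mem_one.2 rfl
    | succ c ih =>
      intro i z hz
      simp only [pow_succ, Set.mem_mul] at hz
      choose x hx y hy hxy using hz
      have : (fun l => atLetter i (z l)) =
          (fun l => atLetter i (x l)) * fun l => atLetter i (y l) :=
        funext fun l => by rw [Pi.mul_apply, ← map_mul, hxy]
      rw [this, map_mul, pow_succ]
      exact Set.mul_mem_mul (ih i x hx) (h8 i y hy)
  refine ⟨n + 1 + 8, ?_⟩
  rintro g ⟨hg, hgm⟩
  obtain ⟨f, hf, rfl⟩ := hb.selfSimilar.exists_levelProd hg hgm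
  have hf' : ∀ l, ∃ u ∈ grigBar ⊓ levelStab 7, ∃ w ∈ grigBar ⊓ levelStab 7, f l = pair u w :=
    fun l => by
      obtain ⟨u, hu, w, hw, he⟩ := mem_levelStab_succ.1 (hf l).2
      have h1 := (hf l).1
      rw [he] at h1
      obtain ⟨h2, h3⟩ := hb.selfSimilar _ _ h1
      exact ⟨u, ⟨h2, hu⟩, w, ⟨h3, hw⟩, he⟩
  choose u hu w hw huw using hf'
  have : f = (fun l => atLetter false (u l)) * fun l => atLetter true (w l) :=
    funext fun l => by rw [huw]; simp
  rw [this, map_mul, show 1024 = 8 * 64 + 8 * 64 from rfl, pow_add, pow_mul]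
  exact Set.mul_mem_mul (hpow 64 _ _ fun l => levelStab_subset_pow (hu l))
    (hpow 64 _ _ fun l => levelStab_subset_pow (hw l))

/-! ### Automatic continuity -/

section Transfer

variable {Γ : Type*} [Group Γ]

theorem image_inv_eq {φ : Γ →* BinAut} {A : Set Γ} (hA : A⁻¹ = A) : (φ '' A)⁻¹ = φ '' A := by
  rw [← Set.image_inv, hA]

/-- The preimage of a neighbourhood of `1` under a homomorphism to a separable group: it is covered
by translates through approximate preimages of the points of a dense sequence. -/
theorem isSigmaSyndetic_preimage {H : Type*} [Group H] [TopologicalSpace H]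
    [IsTopologicalGroup H] [TopologicalSpace.SeparableSpace H] (ψ : Γ →* H)
    {V : Set H} (hV : V ∈ 𝓝 (1 : H)) :
    IsSigmaSyndetic (ψ ⁻¹' V) := by
  classical
  obtain ⟨W, hW, hWV⟩ := exists_nhds_split_inv hV
  let g : ℕ → Γ := fun n =>
    if h : ∃ y, (ψ y)⁻¹ * TopologicalSpace.denseSeq H n ∈ W then h.choose else 1
  refine ⟨g, Set.eq_univ_of_forall fun x => ?_⟩
  have hx : (fun y => (ψ x)⁻¹ * y) ⁻¹' W ∈ 𝓝 (ψ x) := by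
    have : ContinuousAt (fun y => (ψ x)⁻¹ * y) (ψ x) := by fun_prop
    exact this (by simpa using hW)
  obtain ⟨_, hn, n, rfl⟩ := mem_closure_iff_nhds.1
    (TopologicalSpace.denseRange_denseSeq H (ψ x)) _ hx
  have hex : ∃ y, (ψ y)⁻¹ * TopologicalSpace.denseSeq H n ∈ W := ⟨x, hn⟩
  have hg : (ψ (g n))⁻¹ * TopologicalSpace.denseSeq H n ∈ W := by
    simp only [g, dif_pos hex]
    exact hex.choose_spec
  refine Set.mem_iUnion.2 ⟨n, (g n)⁻¹ * x, ?_, by simp⟩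
  have := hWV _ hg _ hn
  simpa [div_eq_mul_inv] using this

variable [TopologicalSpace Γ]

theorem pow_mem_nhds_of_levelStab_subset {φ : Γ →* BinAut} (hφ : IsClosedEmbedding φ)
    (hr : φ.range = grigBar) {A : Set Γ} {k m : ℕ}
    (h : ((grigBar ⊓ levelStab m : Subgroup BinAut) : Set BinAut) ⊆ (φ '' A) ^ k) :
    A ^ k ∈ 𝓝 (1 : Γ) := by
  have h1 : φ ⁻¹' (levelStab m : Set BinAut) ∈ 𝓝 (1 : Γ) :=
    ((isOpen_levelStab m).preimage hφ.continuous).mem_nhds (by simp [one_mem])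
  refine Filter.mem_of_superset h1 fun x hx => ?_
  have h2 := h ⟨hr ▸ ⟨x, rfl⟩, hx⟩
  rw [← Set.image_pow] at h2
  obtain ⟨y, hy, hyx⟩ := h2
  rwa [← hφ.injective hyx]

variable [IsTopologicalGroup Γ]

/-- By the Baire category theorem some translate of `closure A`, and hence `closure A` itself, has
an interior point. -/
theorem IsSigmaSyndetic.inv_mul_mem_nhds [BaireSpace Γ] {A : Set Γ} (hA : IsSigmaSyndetic A) :
    closure (A⁻¹ * A) ∈ 𝓝 (1 : Γ) := by
  obtain ⟨g, hg⟩ := hA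
  obtain ⟨i, hi⟩ := nonempty_interior_of_iUnion_of_closed
    (f := fun i => g i • closure A) (fun i => isClosed_closure.smul (g i)) (by
      rw [Set.eq_univ_iff_forall] at hg ⊢
      intro x
      obtain ⟨i, hi⟩ := Set.mem_iUnion.1 (hg x)
      exact Set.mem_iUnion.2 ⟨i, Set.smul_set_mono subset_closure hi⟩)
  rw [interior_smul] at hi
  obtain ⟨_, y, hy, rfl⟩ := hi
  have ho : IsOpen ((interior (closure A))⁻¹ * interior (closure A)) :=
    isOpen_interior.mul_left
  refine Filter.mem_of_superset (ho.mem_nhds ⟨y⁻¹, by simpa using hy, y, hy, by simp⟩) ?_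
  rintro _ ⟨x, hx, z, hz, rfl⟩
  have hx' := interior_subset (Set.mem_inv.1 hx)
  have := map_mem_closure₂ (f := fun x z : Γ => x⁻¹ * z) (by fun_prop) hx' (interior_subset hz)
    (u := A⁻¹ * A) fun a ha b hb => Set.mul_mem_mul (Set.inv_mem_inv.2 ha) hb
  simpa using this

/-- The image of `A⁻¹ A` in the closure of the Grigorchuk group approximates all elements of some
level stabilizer. -/
theorem IsSigmaSyndetic.exists_approx [BaireSpace Γ] {φ : Γ →* BinAut} (hφ : IsClosedEmbedding φ)
    (hr : φ.range = grigBar) {A : Set Γ} (hA : IsSigmaSyndetic A) :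
    ∃ n, ∀ g ∈ grigBar ⊓ levelStab n, ∀ m, ∃ β ∈ (φ '' A)⁻¹ * φ '' A, β⁻¹ * g ∈ levelStab m := by
  have h1 := hA.inv_mul_mem_nhds
  rw [hφ.isInducing.nhds_eq_comap, map_one,
    (nhds_one_hasBasis.comap φ).mem_iff] at h1
  obtain ⟨n, -, hn⟩ := h1
  refine ⟨n, fun g hg => ?_⟩
  obtain ⟨x, rfl⟩ : g ∈ φ.range := hr ▸ hg.1
  have h2 : φ x ∈ closure ((φ '' A)⁻¹ * φ '' A) :=
    map_mem_closure hφ.continuous (hn hg.2) (by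
      rintro _ ⟨y, hy, z, hz, rfl⟩
      exact ⟨φ y, Set.mem_inv.2 ⟨y⁻¹, hy, by simp⟩, φ z, ⟨z, hz, rfl⟩, by simp⟩)
  exact mem_closure_iff_levelStab.1 h2

theorem weakSteinhausProperty [BaireSpace Γ] {φ : Γ →* BinAut} (hφ : IsClosedEmbedding φ)
    (hr : φ.range = grigBar) : WeakSteinhausProperty Γ := fun A hA hs => by
  obtain ⟨n, hn⟩ := hs.exists_approx hφ hr
  rw [image_inv_eq hA, ← pow_two] at hn
  obtain ⟨g, hg⟩ := hs
  obtain ⟨k, m, h⟩ := exists_levelStab_subset_pow (B := φ '' A) (h := fun i => φ (g i))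
    (by
      rintro _ ⟨x, -, rfl⟩
      exact hr ▸ ⟨x, rfl⟩)
    (image_inv_eq hA) (by
      intro y hy
      obtain ⟨x, rfl⟩ : y ∈ φ.range := hr ▸ hy
      obtain ⟨i, a, ha, he⟩ := Set.mem_iUnion.1 (hg ▸ Set.mem_univ x)
      exact ⟨i, φ a, ⟨a, ha, rfl⟩, by rw [← map_mul, ← he]; rfl⟩) hn
  exact ⟨k, pow_mem_nhds_of_levelStab_subset hφ hr h⟩

/-- For conjugation invariant sets the exponent in the weak Steinhaus property can be fixed. -/
theorem pow_mem_nhds_of_invariant [BaireSpace Γ] {φ : Γ →* BinAut} (hφ : IsClosedEmbedding φ)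
    (hr : φ.range = grigBar) {A : Set Γ} (hA : A⁻¹ = A) (hs : IsSigmaSyndetic A)
    (hconj : ∀ g : Γ, ∀ x ∈ A, g * x * g⁻¹ ∈ A) : A ^ 1024 ∈ 𝓝 (1 : Γ) := by
  obtain ⟨n, hn⟩ := hs.exists_approx hφ hr
  rw [image_inv_eq hA, ← pow_two] at hn
  obtain ⟨m, h⟩ := exists_levelStab_subset_pow_of_invariant (B := φ '' A) (image_inv_eq hA) (by
    intro g hg
    obtain ⟨y, rfl⟩ : g ∈ φ.range := hr ▸ hg
    rintro _ ⟨x, hx, rfl⟩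
    exact ⟨_, hconj y x hx, by simp⟩) hn
  exact pow_mem_nhds_of_levelStab_subset hφ hr h

theorem exists_pow_subset {H : Type*} [Monoid H] [TopologicalSpace H] [ContinuousMul H]
    (j : ℕ) {U : Set H} (hU : U ∈ 𝓝 (1 : H)) : ∃ V ∈ 𝓝 (1 : H), V ^ 2 ^ j ⊆ U := by
  induction j generalizing U with
  | zero => exact ⟨U, hU, by simp⟩
  | succ j ih =>
    obtain ⟨W, hWo, hW1, hW⟩ := exists_open_nhds_one_mul_subset hU
    obtain ⟨V, hV, hVW⟩ := ih (hWo.mem_nhds hW1)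
    refine ⟨V, hV, ?_⟩
    rw [pow_succ, mul_two, pow_add]
    exact (Set.mul_subset_mul hVW hVW).trans hW

/-- The exponent in `pow_mem_nhds_of_invariant` does not depend on the set, so one chooses an
invariant neighbourhood whose power `1024 = 2 ^ 10` is still contained in the given one. -/
theorem invariantAutomaticContinuityProperty [BaireSpace Γ] {φ : Γ →* BinAut}
    (hφ : IsClosedEmbedding φ) (hr : φ.range = grigBar) :
    InvariantAutomaticContinuityProperty Γ := by
  intro H _ _ _ _ hSIN ψ
  refine continuous_of_continuousAt_one ψ fun U hU => ?_
  rw [map_one] at hU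
  obtain ⟨V, hV, hVU⟩ := exists_pow_subset 10 hU
  obtain ⟨W, hW, hWV, hWc⟩ := hSIN V hV
  have hA := pow_mem_nhds_of_invariant hφ hr (A := ψ ⁻¹' (W ∩ W⁻¹)) (by
      ext x
      simp [and_comm])
    (isSigmaSyndetic_preimage ψ (Filter.inter_mem hW (inv_mem_nhds_one H hW))) (by
      rintro g x ⟨hx, hx'⟩
      refine ⟨by simpa using hWc (ψ g) _ hx, ?_⟩
      have := hWc (ψ g) _ hx'
      simpa [mul_assoc] using this)
  refine Filter.mem_map.2 (Filter.mem_of_superset hA fun x hx => hVU ?_)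
  have h1 : ψ x ∈ ψ '' ((ψ ⁻¹' (W ∩ W⁻¹)) ^ 1024) := ⟨x, hx, rfl⟩
  rw [Set.image_pow] at h1
  exact Set.pow_subset_pow_left
    ((Set.image_preimage_subset _ _).trans (Set.inter_subset_left.trans hWV)) h1

/-- Compact groups are small invariant neighbourhood groups. -/
theorem isSINGroup_of_compact (H : Type*) [Group H] [TopologicalSpace H] [IsTopologicalGroup H]
    [CompactSpace H] : IsSINGroup H := fun U hU => by
  have h1 : ∀ᶠ x in 𝓝 (1 : H), ∀ g ∈ (Set.univ : Set H), g * x * g⁻¹ ∈ U := by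
    refine isCompact_univ.eventually_forall_of_forall_eventually fun g _ => ?_
    have hc : ContinuousAt (fun z : H × H => z.2 * z.1 * z.2⁻¹) (1, g) := by fun_prop
    exact hc (by simpa using hU)
  refine ⟨{x | ∀ g : H, g * x * g⁻¹ ∈ U}, ?_, fun x hx => by simpa using hx 1, fun g x hx h => ?_⟩
  · filter_upwards [h1] with x hx g using hx g trivial
  · have := hx (h * g)
    simpa [mul_assoc] using this

theorem isCompact_pow {H : Type*} [Monoid H] [TopologicalSpace H] [ContinuousMul H] {V : Set H}
    (hV : IsCompact V) (n : ℕ) : IsCompact (V ^ n) := by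
  induction n with
  | zero => rw [pow_zero]; exact isCompact_singleton
  | succ n ih => rw [pow_succ]; exact ih.mul hV

/-- A homomorphism from a compact group with the weak Steinhaus property to a locally compact
separable group has relatively compact image. -/
theorem WeakSteinhausProperty.isCompact_closure_range [CompactSpace Γ]
    (h : WeakSteinhausProperty Γ) {H : Type*} [Group H] [TopologicalSpace H]
    [IsTopologicalGroup H] [T2Space H] [TopologicalSpace.SeparableSpace H]
    [LocallyCompactSpace H] (ψ : Γ →* H) :
    IsCompact (closure (Set.range ψ)) := by
  obtain ⟨V, hVc, hV⟩ := exists_compact_mem_nhds (1 : H)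
  obtain ⟨n, hn⟩ := h (ψ ⁻¹' (V ∩ V⁻¹)) (by ext x; simp [and_comm])
    (isSigmaSyndetic_preimage ψ (Filter.inter_mem hV (inv_mem_nhds_one H hV)))
  obtain ⟨t, ht⟩ := isCompact_univ.elim_nhds_subcover
    (fun x : Γ => x • (ψ ⁻¹' (V ∩ V⁻¹)) ^ n) fun x _ => by
      simpa using smul_mem_nhds_smul x hn
  have hc : IsCompact (⋃ x ∈ t, ψ x • V ^ n) :=
    t.isCompact_biUnion fun x _ => (isCompact_pow hVc n).smul (ψ x)
  refine hc.of_isClosed_subset isClosed_closure (closure_minimal ?_ hc.isClosed)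
  rintro _ ⟨y, rfl⟩
  obtain ⟨x, hx, z, hz, rfl⟩ := Set.mem_iUnion₂.1 (ht.2 (Set.mem_univ y))
  refine Set.mem_iUnion₂.2 ⟨x, hx, ψ z, ?_, by simp⟩
  have h1 : ψ z ∈ ψ '' ((ψ ⁻¹' (V ∩ V⁻¹)) ^ n) := ⟨z, hz, rfl⟩
  rw [Set.image_pow] at h1
  exact Set.pow_subset_pow_left
    ((Set.image_preimage_subset _ _).trans Set.inter_subset_left) h1

/-- The closure of the image is compact, hence has small invariant neighbourhoods. -/
theorem locallyCompactAutomaticContinuityProperty [CompactSpace Γ]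
    (h : WeakSteinhausProperty Γ) (h' : InvariantAutomaticContinuityProperty Γ) :
    LocallyCompactAutomaticContinuityProperty Γ := by
  intro H _ _ _ _ _ ψ
  set D := ψ.range.topologicalClosure with hD
  have hDc : IsCompact (D : Set H) := h.isCompact_closure_range ψ
  have : CompactSpace D := isCompact_iff_compactSpace.1 hDc
  have : PolishSpace D := hDc.isClosed.polishSpace
  have hc := h' D (isSINGroup_of_compact D)
    (ψ.codRestrict D fun x => Subgroup.le_topologicalClosure _ ⟨x, rfl⟩)
  exact continuous_subtype_val.comp hc

theorem WeakSteinhausProperty.countableIndexProperty (h : WeakSteinhausProperty Γ) :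
    CountableIndexProperty Γ := fun H hH => by
  obtain ⟨f, hf⟩ := exists_surjective_nat (Γ ⧸ H)
  obtain ⟨n, hn⟩ := h (H : Set Γ) (by ext x; simp) ⟨fun i => (f i).out, by
    refine Set.eq_univ_of_forall fun x => ?_
    obtain ⟨i, hi⟩ := hf (QuotientGroup.mk x)
    refine Set.mem_iUnion.2 ⟨i, ((f i).out)⁻¹ * x, ?_, by simp⟩
    rw [hi]
    exact QuotientGroup.eq.1 (QuotientGroup.out_eq' _)⟩
  refine Subgroup.isOpen_of_mem_nhds H (g := 1) (Filter.mem_of_superset hn ?_)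
  have : ∀ n, (H : Set Γ) ^ n ⊆ H := fun n => by
    induction n with
    | zero => rw [pow_zero]; exact Set.one_subset.2 (one_mem H)
    | succ n ih =>
      rw [pow_succ]
      rintro _ ⟨x, hx, y, hy, rfl⟩
      exact mul_mem (ih hx) hy
  exact this n

end Transfer

end BranchGroup

open BranchGroup
theorem mainTheorem9 :
    IsProfiniteBranchGroup grigorchukCompletion ∧
    StronglyJustInfinite grigorchukCompletion ∧
    (∃ φ : grigorchukCompletion →* treeAut binary,
      (∀ g : grigorchukGroup, φ (toGrigorchukCompletion g) = g) ∧
      IsBranchEmbedding φ ∧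
      LocallyHasDerangements φ ∧
      HasUniformCommutatorWidths φ) ∧
    NormalCountableIndexProperty grigorchukCompletion ∧
    CountableIndexProperty grigorchukCompletion ∧
    WeakSteinhausProperty grigorchukCompletion ∧
    InvariantAutomaticContinuityProperty grigorchukCompletion ∧
    LocallyCompactAutomaticContinuityProperty grigorchukCompletion := by
  have hφ := isClosedEmbedding_completionHom
  have hr := range_completionHom
  have hb := isBranchEmbedding hφ hr
  have hW := weakSteinhausProperty hφ hr
  have hI := invariantAutomaticContinuityProperty hφ hr
  have hC := hW.countableIndexProperty
  exact ⟨⟨binary, fun _ => le_rfl, completionHom, hb⟩, stronglyJustInfinite hφ hr,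
    ⟨completionHom, completionHom_apply, hb, locallyHasDerangements hr,
      hasUniformCommutatorWidths hφ.injective hr⟩,
    fun N _ hN => hC N hN, hC, hW, hI, locallyCompactAutomaticContinuityProperty hW hI⟩
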